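/- Let $(\mathcal C,\otimes,1_\otimes)$ be a symmetric monoidal category which has all small limits, with terminal object $\star_{\mathcal C}$. **Notation.** $\Sigma_*$ is the category of finite sets and bijections, $\Sigma_0\subset\Sigma_*$ the full subcategory of empty sets. For $n\ge 1$, $\Sigma_*^{\wr n}$ is the groupoid of level-$n$ trees, i.e. of chains of maps of finite sets $\star\leftarrow S_1\leftarrow\dots\leftarrow S_n$ and their isomorphisms; $\Sigma_*^{\wr (n-1)}\wr\Sigma_0$ is its full subcategory given by $S_n=\emptyset$; and $\gamma^n$ is the functor to $\Sigma_*$ (resp. $\Sigma_0$) sending a tree to its set of leaves $S_n$. A symmetric sequence is a functor $\Sigma_*\to\mathcal C$. For a functor $X$ on level-$m$ trees and a functor $Y$ on level-$n$ trees, $X\circledcirc Y$ is the functor on level-$(m+n)$ trees which sends a level-$m$ tree $F$ with a level-$n$ tree $F_s$ at each leaf $s$ to $X(F)\otimes\bigotimes_s Y(F_s)$; this is associative up to canonical isomorphism. Let $A_1\hat\circ\cdots\hat\circ A_n=\mathrm R_{\gamma^n}(A_1\circledcirc\cdots\circledcirc A_n)$ be the right Kan extension along $\gamma^n$, with universal transformation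 $\iota:(A_1\hat\circ\cdots\hat\circ A_n)\gamma^n\to A_1\circledcirc\cdots\circledcirc A_n$; here $A_1,\dots,A_{n-1}$ are symmetric sequences and $A_n$ is a functor on $\Sigma_*$ or on $\Sigma_0$. (For $n=1$ we take $A_1$ itself.) Let $\mathds 1$ be the symmetric sequence equal to $1_\otimes$ on one-element sets and to $\star_{\mathcal C}$ on all other sets. A *(counital) cooperad* is a symmetric sequence $\mathcal O$ with transformations $\tilde\Delta:\mathcal O\gamma^2\to\mathcal O\circledcirc\mathcal O$ and $\tilde\epsilon:\mathcal O\to\mathds 1$ such that the two transformations $\mathcal O\gamma^3\to\mathcal O\circledcirc\mathcal O\circledcirc\mathcal O$ obtained from $\tilde\Delta$ (applying it a second time to the first or to the second factor) agree, and such that the two composites $\mathcal O\to\mathcal O$ given by $\tilde\Delta$ followed by $\tilde\epsilon$ on the first factor, on the trees $\star\leftarrow\star\leftarrow S$, respectively by $\tilde\epsilon$ on the second factor, on the trees $\star\leftarrow S\xleftarrow{=}S$, are the identity. A *comodule* over $\mathcal O$ is a functor $M:\Sigma_*\to\mathcal C$ with a transformation $\tilde\Delta_M:M\gamma^2\to\mathcal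 O\circledcirc M$ which is coassociative in the same sense (the two transformations $M\gamma^3\to\mathcal O\circledcirc\mathcal O\circledcirc M$ agree) and left counital. A *coalgebra* over $\mathcal O$ is an object $c$ of $\mathcal C$, viewed as a constant functor $\Sigma_0\to\mathcal C$, with such a $\tilde\Delta_c:c\,\gamma^2\to\mathcal O\circledcirc c$ on $\Sigma_*\wr\Sigma_0$. Consider all expressions built from copies of $\mathcal O$ and one $M$ in the last position by iterated (arbitrarily parenthesized) products $(E_1\hat\circ\cdots\hat\circ E_k)$, $k\ge 2$. *Parenthesization maps* are the maps induced on right Kan extensions by applying the universal transformation $\iota$ to a factor which is itself a product; they remove a pair of parentheses, e.g. $(A\hat\circ B)\hat\circ C\to A\hat\circ B\hat\circ C\leftarrow A\hat\circ(B\hat\circ C)$. *Cocomposition maps* are the maps $\Delta:\mathcal O\to\mathcal O\hat\circ\mathcal O$ and $\Delta_M:M\to\mathcal O\hat\circ M$ corresponding to $\tilde\Delta$, $\tilde\Delta_M$, and the maps $\Delta_i:E_1\hat\circ\cdots\hat\circ E_k\to E'_1\hat\circ\cdots\hat\circ E'_{k+1}$ induced on right Kan extensions by applying $\tilde\Delta$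 to a factor $E_i=\mathcal O$ (which becomes $\mathcal O\hat\circ\mathcal O$ without new parentheses) or $\tilde\Delta_M$ to the last factor $E_k=M$. *Combinations* are all transformations obtained from these maps and identities by composition and by functoriality of $\hat\circ$ in the factors. Likewise with $c$ in place of $M$. **Corollary.** Let $\mathcal O$ be a cooperad and $n\ge 1$. 1. For every comodule $M$ over $\mathcal O$ there is exactly one transformation $\Delta^{[n]}_M:M\to\mathcal O^{\hat\circ(n-1)}\hat\circ M=\mathrm R_{\gamma^n}(\mathcal O\circledcirc\cdots\circledcirc\mathcal O\circledcirc M)$ which is a combination of parenthesization maps and cocomposition maps; that is, such combinations exist, and any two of them from $M$ to $\mathcal O^{\hat\circ(n-1)}\hat\circ M$ are equal. 2. For every coalgebra $c$ over $\mathcal O$ there is, in the same sense, exactly one map $\Delta^{[n]}:c\to\mathcal O^{\hat\circ(n-1)}\hat\circ c$ in $\mathcal C$ (the target being evaluated at $\emptyset$) which is a combination of parenthesization maps and cocomposition maps. -/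

import Mathlib

open CategoryTheory MonoidalCategory Limits

set_option linter.unusedSectionVars false
set_option linter.unusedSimpArgs false

universe v u v₁ v₂ v₃ u₁ u₂ u₃

namespace TreeSeq

section Coherence

variable {C : Type u} [Category.{v} C] [MonoidalCategory C] [SymmetricCategory C]

/-- The right-bracketed tensor product of the objects `X v`, for `v` running through a list. -/
def tl {V : Type} (X : V → C) : List V → C
  | [] => 𝟙_ C
  | v :: l => X v ⊗ tl X l

/-- Exchange of the first two factors. -/
def swp (a b z : C) : a ⊗ (b ⊗ z) ⟶ b ⊗ (a ⊗ z) :=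
  (α_ a b z).inv ≫ (β_ a b).hom ▷ z ≫ (α_ b a z).hom

lemma swp_swp (a b z : C) : swp a b z ≫ swp b a z = 𝟙 _ := by
  simp [swp, ← comp_whiskerRight_assoc]

lemma swp_nat {a b z a' b' z' : C} (f : a ⟶ a') (g : b ⟶ b') (h : z ⟶ z') :
    (f ⊗ₘ (g ⊗ₘ h)) ≫ swp a' b' z' = swp a b z ≫ (g ⊗ₘ (f ⊗ₘ h)) := by
  simp only [swp, Category.assoc, ← tensorHom_id]
  rw [associator_inv_naturality_assoc]
  rw [tensorHom_comp_tensorHom_assoc, BraidedCategory.braiding_naturality, ← associator_naturality,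
    tensorHom_comp_tensorHom_assoc]
  simp only [Category.id_comp, Category.comp_id]

lemma swp_nat_left {a b z a' : C} (f : a ⟶ a') :
    f ▷ (b ⊗ z) ≫ swp a' b z = swp a b z ≫ b ◁ (f ▷ z) := by
  simpa using swp_nat f (𝟙 b) (𝟙 z)

lemma swp_nat_right {a b z z' : C} (h : z ⟶ z') :
    a ◁ (b ◁ h) ≫ swp a b z' = swp a b z ≫ b ◁ (a ◁ h) := by
  simpa using swp_nat (𝟙 a) (𝟙 b) h

lemma swp_yb (a b c z : C) :
    a ◁ swp b c z ≫ swp a c (b ⊗ z) ≫ c ◁ swp a b z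
      = swp a b (c ⊗ z) ≫ b ◁ swp a c z ≫ swp b c (a ⊗ z) := by
  calc
    _ = 𝟙 _ ⊗≫ (a ◁ (β_ b c).hom ≫ (α_ a c b).inv ≫ (β_ a c).hom ▷ b ≫
          (α_ c a b).hom ≫ c ◁ (β_ a b).hom) ▷ z ⊗≫ 𝟙 _ := by
      simp only [swp]; monoidal
    _ = _ := by
      rw [← BraidedCategory.yang_baxter]; simp only [swp]; monoidal

/-- `Ins v l l'`: the list `l'` arises from `l` by inserting `v` at one position. -/
inductive Ins {V : Type} (v : V) : List V → List V → Type
  | here (l : List V) : Ins v l (v :: l)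
  | there (a : V) {l l' : List V} (i : Ins v l l') : Ins v (a :: l) (a :: l')

/-- The morphism moving the factor `X v` from the front to the place of insertion. -/
def Ins.interp {V : Type} (X : V → C) {v : V} :
    {l l' : List V} → Ins v l l' → (X v ⊗ tl X l ⟶ tl X l')
  | _, _, .here _ => 𝟙 _
  | _, _, .there a i => swp _ _ _ ≫ X a ◁ i.interp X

/-- `Pm σ l l'`: the list `l'` is a rearrangement of the image of the list `l` under `σ`. -/
inductive Pm {V V' : Type} (σ : V → V') : List V → List V' → Type
  | nil : Pm σ [] []
  | cons (v : V) {l : List V} {l₁ l' : List V'} (p : Pm σ l l₁) (i : Ins (σ v) l₁ l') :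
      Pm σ (v :: l) l'

/-- The morphism that applies `φ v` to each factor and permutes the factors. -/
def Pm.interp {V V' : Type} {X : V → C} {X' : V' → C} {σ : V → V'} (φ : ∀ v, X v ⟶ X' (σ v)) :
    {l : List V} → {l' : List V'} → Pm σ l l' → (tl X l ⟶ tl X' l')
  | _, _, .nil => 𝟙 _
  | _, _, .cons v p i => (φ v ⊗ₘ p.interp φ) ≫ i.interp X'

lemma Ins.swap {V : Type} (X : V → C) {a b : V} {l m n : List V} (i : Ins b l m) (j : Ins a m n) :
    ∃ (m' : List V) (j' : Ins a l m') (i' : Ins b m' n),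
      X a ◁ i.interp X ≫ j.interp X
        = swp (X a) (X b) _ ≫ X b ◁ j'.interp X ≫ i'.interp X := by
  induction j generalizing l with
  | here m =>
    refine ⟨_, .here l, .there a i, ?_⟩
    simp only [Ins.interp, tl, MonoidalCategory.whiskerLeft_id, Category.comp_id, Category.id_comp]
    rw [← Category.assoc, swp_swp, Category.id_comp]
  | there c j ih =>
    cases i with
    | here =>
      refine ⟨_, j, .here _, ?_⟩
      simp [tl, Ins.interp]
    | there _ i =>
      obtain ⟨m', j', i', h⟩ := ih i
      refine ⟨_, .there c j', .there c i', ?_⟩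
      simp only [Ins.interp, tl, MonoidalCategory.whiskerLeft_comp, Category.assoc]
      have e1 := swp_nat_right (a := X a) (b := X c) (i.interp X)
      have e2 := swp_nat_right (a := X b) (b := X c) (j'.interp X)
      rw [reassoc_of% e1, reassoc_of% e2, ← MonoidalCategory.whiskerLeft_comp, h]
      simp only [MonoidalCategory.whiskerLeft_comp]
      have := swp_yb (X a) (X b) (X c)
      rw [reassoc_of% this]

lemma Pm.remove {V V' : Type} {X : V → C} {X' : V' → C} {τ : V → V'} (ψ : ∀ v, X v ⟶ X' (τ v))
    {v : V} {l₁ l' : List V} {l'' : List V'} (i : Ins v l₁ l') (q : Pm τ l' l'') :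
    ∃ (l₂ : List V') (j : Ins (τ v) l₂ l'') (q' : Pm τ l₁ l₂),
      i.interp X ≫ q.interp ψ = (ψ v ⊗ₘ q'.interp ψ) ≫ j.interp X' := by
  induction i generalizing l'' with
  | here l =>
    cases q with
    | cons _ p j => exact ⟨_, j, p, by simp [tl, Ins.interp, Pm.interp]⟩
  | there a i ih =>
    cases q with
    | cons _ p k =>
      obtain ⟨l₂, j, q', h⟩ := ih p
      obtain ⟨m', k', j', h'⟩ := j.swap X' k
      refine ⟨_, j', .cons a q' k', ?_⟩
      simp only [tl, Ins.interp, Pm.interp, Category.assoc]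
      rw [← id_tensorHom, tensorHom_comp_tensorHom_assoc, h, Category.id_comp]
      have e1 : ψ a ⊗ₘ ((ψ v ⊗ₘ q'.interp ψ) ≫ j.interp X')
          = (ψ a ⊗ₘ (ψ v ⊗ₘ q'.interp ψ)) ≫ X' (τ a) ◁ j.interp X' := by
        rw [← id_tensorHom, tensorHom_comp_tensorHom, Category.comp_id]
      rw [e1, Category.assoc, h', ← Category.assoc (ψ a ⊗ₘ _), swp_nat, Category.assoc,
        ← Category.assoc (swp _ _ _), swp_swp, Category.id_comp]
      rw [← id_tensorHom, tensorHom_comp_tensorHom_assoc, Category.comp_id]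

lemma Pm.comp {V V' V'' : Type} {X : V → C} {X' : V' → C} {X'' : V'' → C}
    {σ : V → V'} {τ : V' → V''}
    {φ : ∀ v, X v ⟶ X' (σ v)} {ψ : ∀ v, X' v ⟶ X'' (τ v)}
    {l : List V} {l' : List V'} {l'' : List V''} (p : Pm σ l l') (q : Pm τ l' l'') :
    ∃ r : Pm (fun v => τ (σ v)) l l'',
      p.interp φ ≫ q.interp ψ = r.interp (fun v => φ v ≫ ψ (σ v)) := by
  induction p generalizing l'' with
  | nil => cases q; exact ⟨.nil, by simp [tl, Pm.interp]⟩
  | cons v p i ih =>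
    obtain ⟨l₂, j, q', h⟩ := Pm.remove ψ i q
    obtain ⟨r, hr⟩ := ih q'
    refine ⟨.cons v r j, ?_⟩
    simp only [Pm.interp, tl, Category.assoc, h]
    rw [tensorHom_comp_tensorHom_assoc, hr]

lemma Ins.mem {V : Type} {v : V} {l l' : List V} (i : Ins v l l') : v ∈ l' := by
  induction i <;> simp_all

lemma Ins.perm {V : Type} {v : V} {l l' : List V} (i : Ins v l l') : (v :: l).Perm l' := by
  induction i with
  | here => exact .refl _
  | there a i ih => exact (List.Perm.swap _ _ _).trans (ih.cons a)

lemma Pm.perm {V V' : Type} {σ : V → V'} {l : List V} {l' : List V'} (p : Pm σ l l') :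
    (l.map σ).Perm l' := by
  induction p with
  | nil => exact .refl _
  | cons v p i ih => exact (ih.cons _).trans i.perm

lemma Ins.unique {V : Type} {v : V} {l m l' : List V} (i : Ins v l l') (j : Ins v m l')
    (h : l'.Nodup) : l = m ∧ i ≍ j := by
  induction i generalizing m with
  | here l =>
    cases j with
    | here => exact ⟨rfl, .rfl⟩
    | there _ j => exact absurd j.mem (List.nodup_cons.1 h).1
  | there a i ih =>
    cases j with
    | here => exact absurd i.mem (List.nodup_cons.1 h).1
    | there _ j =>
      obtain ⟨rfl, h'⟩ := ih j (List.nodup_cons.1 h).2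
      cases h'
      exact ⟨rfl, .rfl⟩

lemma Pm.unique {V V' : Type} {σ : V → V'} {l : List V} {l' : List V'} (p q : Pm σ l l')
    (h : l'.Nodup) : p = q := by
  induction p with
  | nil => cases q; rfl
  | cons v p i ih =>
    cases q with
    | cons _ q j =>
      obtain ⟨rfl, h'⟩ := i.unique j h
      cases h'
      rw [ih q (List.nodup_cons.1 (i.perm.nodup_iff.2 h)).2]

lemma Ins.exists {V : Type} (v : V) (s t : List V) : Nonempty (Ins v (s ++ t) (s ++ v :: t)) := by
  induction s with
  | nil => exact ⟨.here _⟩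
  | cons a s ih => exact ih.map (.there a)

lemma Pm.exists {V V' : Type} {σ : V → V'} {l : List V} {l' : List V'}
    (h : (l.map σ).Perm l') : Nonempty (Pm σ l l') := by
  induction l generalizing l' with
  | nil => rw [List.map_nil, List.nil_perm] at h; subst h; exact ⟨.nil⟩
  | cons v l ih =>
    obtain ⟨s, t, rfl⟩ := List.append_of_mem (h.subset List.mem_cons_self)
    obtain ⟨i⟩ := Ins.exists (σ v) s t
    obtain ⟨p⟩ := ih (l' := s ++ t) (List.Perm.cons_inv (h.trans i.perm.symm))
    exact ⟨.cons v p i⟩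

/-- Concatenation of lists corresponds to the tensor product. -/
def app {V : Type} (X : V → C) : (l k : List V) → (tl X l ⊗ tl X k ≅ tl X (l ++ k))
  | [], _ => λ_ _
  | v :: l, k => α_ (X v) (tl X l) (tl X k) ≪≫ whiskerLeftIso (X v) (app X l k)

lemma Ins.append {V : Type} (X : V → C) {v : V} {l l' : List V} (i : Ins v l l') (k : List V) :
    ∃ j : Ins v (l ++ k) (l' ++ k),
      X v ◁ (app X l k).hom ≫ j.interp X = (α_ _ _ _).inv ≫ i.interp X ▷ tl X k ≫ (app X l' k).hom := by
  induction i with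
  | here l => exact ⟨.here _, by simp [tl, Ins.interp, app]⟩
  | @there a l₀ _ i ih =>
    obtain ⟨j, h⟩ := ih
    refine ⟨.there a j, ?_⟩
    simp only [tl, List.cons_append, Ins.interp, app, Iso.trans_hom, whiskerLeftIso_hom]
    rw [MonoidalCategory.whiskerLeft_comp, Category.assoc]
    change _ ≫ X v ◁ X a ◁ (app X l₀ k).hom ≫ swp (X v) (X a) (tl X (l₀ ++ k)) ≫ _ = _
    have e1 := swp_nat_right (a := X v) (b := X a) (app X l₀ k).hom
    rw [reassoc_of% e1, ← MonoidalCategory.whiskerLeft_comp, h]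
    simp only [swp]
    monoidal

lemma Pm.append {V V' : Type} {X : V → C} {X' : V' → C} {σ : V → V'} (φ : ∀ v, X v ⟶ X' (σ v))
    {l k : List V} {l' k' : List V'} (p : Pm σ l l') (q : Pm σ k k') :
    ∃ r : Pm σ (l ++ k) (l' ++ k'),
      (app X l k).hom ≫ r.interp φ = (p.interp φ ⊗ₘ q.interp φ) ≫ (app X' l' k').hom := by
  induction p with
  | nil => exact ⟨q, by simp [tl, Pm.interp, app]⟩
  | @cons v l₀ _ _ p i ih =>
    obtain ⟨r, hr⟩ := ih
    obtain ⟨j, hj⟩ := i.append X' k'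
    refine ⟨.cons v r j, ?_⟩
    simp only [tl, List.cons_append, Pm.interp, app, Iso.trans_hom, whiskerLeftIso_hom,
      Category.assoc]
    rw [← id_tensorHom, tensorHom_comp_tensorHom_assoc, hr, Category.id_comp]
    have e1 {a b c : C} (f : X v ⟶ a) (g : tl X l₀ ⊗ tl X k ⟶ b) (h : b ⟶ c) :
      f ⊗ₘ (g ≫ h) = (f ⊗ₘ g) ≫ a ◁ h := by
      rw [← id_tensorHom, tensorHom_comp_tensorHom, Category.comp_id]
    rw [e1, Category.assoc, hj, associator_inv_naturality_assoc, Iso.hom_inv_id_assoc,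
      ← tensorHom_id, tensorHom_comp_tensorHom_assoc, Category.comp_id]

lemma Pm.refl {V : Type} (X : V → C) (l : List V) :
    ∃ r : Pm (fun v => v) l l, r.interp (X := X) (X' := X) (fun v => 𝟙 (X v)) = 𝟙 _ := by
  induction l with
  | nil => exact ⟨.nil, rfl⟩
  | cons v l ih =>
    obtain ⟨r, hr⟩ := ih
    exact ⟨.cons v r (.here _), by simp [Pm.interp, Ins.interp, tl, hr]⟩

lemma Pm.assoc {V : Type} (X : V → C) (l k m : List V) :
    ∃ r : Pm (fun v => v) ((l ++ k) ++ m) (l ++ (k ++ m)),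
      ((app X l k).hom ▷ _ ≫ (app X (l ++ k) m).hom) ≫
          r.interp (X := X) (X' := X) (fun v => 𝟙 (X v))
        = (α_ _ _ _).hom ≫ _ ◁ (app X k m).hom ≫ (app X l (k ++ m)).hom := by
  induction l with
  | nil =>
    obtain ⟨r, hr⟩ := Pm.refl X (k ++ m)
    exact ⟨r, by simp [tl, hr, app]⟩
  | cons v l ih =>
    obtain ⟨r, hr⟩ := ih
    refine ⟨.cons v r (.here _), ?_⟩
    simp only [tl, List.cons_append, app, Pm.interp, Ins.interp, Iso.trans_hom, whiskerLeftIso_hom,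
      Category.assoc, id_tensorHom, Category.comp_id] at hr ⊢
    calc
      _ = 𝟙 _ ⊗≫ X v ◁ ((app X l k).hom ▷ tl X m ≫ (app X (l ++ k) m).hom ≫
          r.interp (X := X) (X' := X) (fun v => 𝟙 (X v))) := by monoidal
      _ = _ := by rw [hr]; monoidal

lemma Pm.assoc_inv {V : Type} (X : V → C) (l k m : List V) :
    ∃ r : Pm (fun v => v) (l ++ (k ++ m)) ((l ++ k) ++ m),
      (_ ◁ (app X k m).hom ≫ (app X l (k ++ m)).hom) ≫
          r.interp (X := X) (X' := X) (fun v => 𝟙 (X v))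
        = (α_ _ _ _).inv ≫ (app X l k).hom ▷ _ ≫ (app X (l ++ k) m).hom := by
  induction l with
  | nil =>
    obtain ⟨r, hr⟩ := Pm.refl X (k ++ m)
    exact ⟨r, by simp [tl, hr, app]⟩
  | cons v l ih =>
    obtain ⟨r, hr⟩ := ih
    refine ⟨.cons v r (.here _), ?_⟩
    simp only [tl, List.cons_append, app, Pm.interp, Ins.interp, Iso.trans_hom, whiskerLeftIso_hom,
      Category.assoc, id_tensorHom, Category.comp_id] at hr ⊢
    calc
      _ = 𝟙 _ ⊗≫ X v ◁ (tl X l ◁ (app X k m).hom ≫ (app X l (k ++ m)).hom ≫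
          r.interp (X := X) (X' := X) (fun v => 𝟙 (X v))) := by monoidal
      _ = _ := by rw [hr]; monoidal

lemma Ins.block {V : Type} (X : V → C) (a : V) (m l : List V) :
    ∃ i : Ins a (m ++ l) (m ++ a :: l),
      X a ◁ (app X m l).hom ≫ i.interp X = swp _ _ _ ≫ (app X m (a :: l)).hom := by
  induction m with
  | nil =>
    refine ⟨.here _, ?_⟩
    simp [tl, Ins.interp, app, swp]
  | cons b m ih =>
    obtain ⟨i, hi⟩ := ih
    refine ⟨.there b i, ?_⟩
    dsimp only [List.cons_append, tl, Ins.interp, app, Iso.trans_hom, whiskerLeftIso_hom] at hi ⊢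
    rw [MonoidalCategory.whiskerLeft_comp, Category.assoc]
    change _ ≫ X a ◁ X b ◁ (app X m l).hom ≫ swp (X a) (X b) (tl X (m ++ l)) ≫ _
      = _ ≫ _ ≫ X b ◁ (app X m (a :: l)).hom
    have e1 := swp_nat_right (a := X a) (b := X b) (app X m l).hom
    rw [reassoc_of% e1, ← MonoidalCategory.whiskerLeft_comp, hi]
    simp only [swp, BraidedCategory.braiding_tensor_right_hom]
    monoidal

lemma Pm.unit {V : Type} (X : V → C) (l : List V) :
    ∃ r : Pm (fun v => v) l (l ++ []),
      r.interp (X := X) (X' := X) (fun v => 𝟙 (X v)) = (ρ_ _).inv ≫ (app X l []).hom := by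
  induction l with
  | nil => exact ⟨.nil, by simp [tl, Pm.interp, app, unitors_equal]⟩
  | cons v l ih =>
    obtain ⟨r, hr⟩ := ih
    refine ⟨.cons v r (.here _), ?_⟩
    simp only [tl, List.cons_append, app, Pm.interp, Ins.interp, Iso.trans_hom, whiskerLeftIso_hom,
      id_tensorHom, Category.comp_id, hr]
    simp
    rfl

lemma Pm.braid {V : Type} (X : V → C) (l m : List V) :
    ∃ r : Pm (fun v => v) (l ++ m) (m ++ l),
      (app X l m).hom ≫ r.interp (X := X) (X' := X) (fun v => 𝟙 (X v))
        = (β_ _ _).hom ≫ (app X m l).hom := by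
  induction l with
  | nil =>
    obtain ⟨r, hr⟩ := Pm.unit X m
    exact ⟨r, by simp [tl, hr, app]⟩
  | cons a l ih =>
    obtain ⟨r, hr⟩ := ih
    obtain ⟨i, hi⟩ := Ins.block X a m l
    refine ⟨.cons a r i, ?_⟩
    simp only [tl, List.cons_append, Pm.interp, app, Iso.trans_hom, whiskerLeftIso_hom,
      Category.assoc, id_tensorHom] at hi ⊢
    rw [← MonoidalCategory.whiskerLeft_comp_assoc, hr, MonoidalCategory.whiskerLeft_comp_assoc, hi]
    simp [swp, BraidedCategory.braiding_tensor_left_hom]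

/-- A way of writing an object of `C` as a bracketed tensor product of the unit and objects `X v`. -/
inductive Wd {V : Type} (X : V → C) : C → Type u
  | one : Wd X (𝟙_ C)
  | of (v : V) : Wd X (X v)
  | mul {a b : C} (w : Wd X a) (w' : Wd X b) : Wd X (a ⊗ b)

/-- The list of indices occurring in a bracketed tensor product. -/
def Wd.leaves {V : Type} {X : V → C} : {a : C} → Wd X a → List V
  | _, .one => []
  | _, .of v => [v]
  | _, .mul w w' => w.leaves ++ w'.leaves

/-- Rebracketing to the right and removing units. -/
def Wd.nf {V : Type} {X : V → C} : {a : C} → (w : Wd X a) → (a ≅ tl X w.leaves)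
  | _, .one => Iso.refl _
  | _, .of v => (ρ_ (X v)).symm
  | _, .mul w w' => (w.nf ⊗ᵢ w'.nf) ≪≫ app X w.leaves w'.leaves

/-- `f` applies `φ v` to each factor `X v` and then rearranges factors by a composite of
associativity, unit and symmetry isomorphisms. -/
def Fm {V V' : Type} {X : V → C} {X' : V' → C} (σ : V → V') (φ : ∀ v, X v ⟶ X' (σ v))
    {a a' : C} (w : Wd X a) (w' : Wd X' a') (f : a ⟶ a') : Prop :=
  ∃ p : Pm σ w.leaves w'.leaves, f ≫ w'.nf.hom = w.nf.hom ≫ p.interp φ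

section

variable {V V' V'' : Type} {X : V → C} {X' : V' → C} {X'' : V'' → C}
  {σ : V → V'} {φ : ∀ v, X v ⟶ X' (σ v)}

/-- Coherence: such a morphism is unique as soon as no index is repeated. -/
lemma Fm.unique {a a' : C} {w : Wd X a} {w' : Wd X' a'} {f g : a ⟶ a'}
    (hf : Fm σ φ w w' f) (hg : Fm σ φ w w' g) (h : w'.leaves.Nodup) : f = g := by
  obtain ⟨p, hp⟩ := hf
  obtain ⟨q, hq⟩ := hg
  rw [← cancel_mono w'.nf.hom, hp, hq, p.unique q h]

lemma Fm.exists {a a' : C} (w : Wd X a) (w' : Wd X' a')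
    (h : (w.leaves.map σ).Perm w'.leaves) : ∃ f, Fm σ φ w w' f := by
  obtain ⟨p⟩ := Pm.exists h
  exact ⟨w.nf.hom ≫ p.interp φ ≫ w'.nf.inv, p, by simp⟩

lemma Fm.comp {τ : V' → V''} {ψ : ∀ v, X' v ⟶ X'' (τ v)} {χ : ∀ v, X v ⟶ X'' (τ (σ v))}
    {a a' a'' : C} {w : Wd X a} {w' : Wd X' a'} {w'' : Wd X'' a''} {f : a ⟶ a'} {g : a' ⟶ a''}
    (hf : Fm σ φ w w' f) (hg : Fm τ ψ w' w'' g) (hχ : ∀ v, φ v ≫ ψ (σ v) = χ v) :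
    Fm (fun v => τ (σ v)) χ w w'' (f ≫ g) := by
  obtain rfl : (fun v => φ v ≫ ψ (σ v)) = χ := funext hχ
  obtain ⟨p, hp⟩ := hf
  obtain ⟨q, hq⟩ := hg
  obtain ⟨r, hr⟩ := p.comp q (φ := φ) (ψ := ψ)
  exact ⟨r, by rw [Category.assoc, hq, reassoc_of% hp, hr]⟩

lemma Fm.of (v : V) : Fm σ φ (.of v) (.of (σ v)) (φ v) :=
  ⟨.cons v .nil (.here _), by simp [Wd.nf, Pm.interp, Ins.interp, Wd.leaves, tl]⟩

lemma Fm.one : Fm σ φ .one .one (𝟙 _) :=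
  ⟨.nil, by simp [Wd.nf, Pm.interp, Wd.leaves, tl]⟩

lemma Fm.mul {a a' b b' : C} {w : Wd X a} {w' : Wd X' a'} {f : a ⟶ a'} {u : Wd X b}
    {u' : Wd X' b'} {g : b ⟶ b'} (hf : Fm σ φ w w' f) (hg : Fm σ φ u u' g) :
    Fm σ φ (.mul w u) (.mul w' u') (f ⊗ₘ g) := by
  obtain ⟨p, hp⟩ := hf
  obtain ⟨q, hq⟩ := hg
  obtain ⟨r, hr⟩ := p.append φ q
  refine ⟨r, ?_⟩
  simp only [Wd.nf, Wd.leaves, Iso.trans_hom, tensorIso_hom, Category.assoc]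
  rw [hr, tensorHom_comp_tensorHom_assoc, hp, hq, tensorHom_comp_tensorHom_assoc]

lemma Fm.id {a : C} (w : Wd X a) : Fm (fun v => v) (fun v => 𝟙 (X v)) w w (𝟙 a) := by
  obtain ⟨r, hr⟩ := Pm.refl X w.leaves
  exact ⟨r, by rw [hr]; simp⟩

lemma Wd.nf_left {a b c : C} (w : Wd X a) (w' : Wd X b) (w'' : Wd X c) :
    (Wd.mul (.mul w w') w'').nf.hom = ((w.nf.hom ⊗ₘ w'.nf.hom) ⊗ₘ w''.nf.hom) ≫
      (app X w.leaves w'.leaves).hom ▷ _ ≫ (app X (w.leaves ++ w'.leaves) w''.leaves).hom := by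
  simp only [Wd.nf, Wd.leaves, Iso.trans_hom, tensorIso_hom]
  rw [← tensorHom_id, tensorHom_comp_tensorHom_assoc, Category.comp_id]

lemma Wd.nf_right {a b c : C} (w : Wd X a) (w' : Wd X b) (w'' : Wd X c) :
    (Wd.mul w (.mul w' w'')).nf.hom = (w.nf.hom ⊗ₘ (w'.nf.hom ⊗ₘ w''.nf.hom)) ≫
      _ ◁ (app X w'.leaves w''.leaves).hom ≫ (app X w.leaves (w'.leaves ++ w''.leaves)).hom := by
  simp only [Wd.nf, Wd.leaves, Iso.trans_hom, tensorIso_hom]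
  rw [← id_tensorHom, tensorHom_comp_tensorHom_assoc, Category.comp_id]

lemma Fm.assoc {a b c : C} (w : Wd X a) (w' : Wd X b) (w'' : Wd X c) :
    Fm (fun v => v) (fun v => 𝟙 (X v)) (.mul (.mul w w') w'') (.mul w (.mul w' w''))
      (α_ a b c).hom := by
  obtain ⟨r, hr⟩ := Pm.assoc X w.leaves w'.leaves w''.leaves
  refine ⟨r, ?_⟩
  refine Eq.trans ((congrArg ((α_ a b c).hom ≫ ·) (Wd.nf_right w w' w'')).trans
    (associator_naturality_assoc _ _ _ _).symm) ?_
  refine Eq.trans (congrArg (((w.nf.hom ⊗ₘ w'.nf.hom) ⊗ₘ w''.nf.hom) ≫ ·) hr.symm) ?_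
  exact (Category.assoc _ _ _).symm.trans (congrArg (· ≫ _) (Wd.nf_left w w' w'').symm)

lemma Fm.assoc_inv {a b c : C} (w : Wd X a) (w' : Wd X b) (w'' : Wd X c) :
    Fm (fun v => v) (fun v => 𝟙 (X v)) (.mul w (.mul w' w'')) (.mul (.mul w w') w'')
      (α_ a b c).inv := by
  obtain ⟨r, hr⟩ := Pm.assoc_inv X w.leaves w'.leaves w''.leaves
  refine ⟨r, ?_⟩
  refine Eq.trans ((congrArg ((α_ a b c).inv ≫ ·) (Wd.nf_left w w' w'')).trans
    (associator_inv_naturality_assoc _ _ _ _).symm) ?_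
  refine Eq.trans (congrArg ((w.nf.hom ⊗ₘ (w'.nf.hom ⊗ₘ w''.nf.hom)) ≫ ·) hr.symm) ?_
  exact (Category.assoc _ _ _).symm.trans (congrArg (· ≫ _) (Wd.nf_right w w' w'').symm)

lemma Fm.braid {a b : C} (w : Wd X a) (w' : Wd X b) :
    Fm (fun v => v) (fun v => 𝟙 (X v)) (.mul w w') (.mul w' w) (β_ a b).hom := by
  obtain ⟨r, hr⟩ := Pm.braid X w.leaves w'.leaves
  refine ⟨r, ?_⟩
  simp only [Wd.nf, Wd.leaves, Iso.trans_hom, tensorIso_hom, Category.assoc]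
  rw [hr, BraidedCategory.braiding_naturality_assoc]

lemma Fm.swp {a b z : C} (w : Wd X a) (w' : Wd X b) (w'' : Wd X z) :
    Fm (fun v => v) (fun v => 𝟙 (X v)) (.mul w (.mul w' w'')) (.mul w' (.mul w w''))
      (swp a b z) := by
  refine (Fm.assoc_inv w w' w'').comp (((Fm.braid w w').mul (Fm.id w'')).comp
    (Fm.assoc w' w w'') (χ := fun v => 𝟙 (X v)) fun _ => Category.comp_id _)
      (fun _ => Category.comp_id _) |> cast ?_
  simp [TreeSeq.swp]

end

/-- The bracketing of `tl Z l` obtained from bracketings of all the objects `Z t`. -/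
def Wd.tl {V T : Type} {X : V → C} {Z : T → C} (w : ∀ t, Wd X (Z t)) :
    (l : List T) → Wd X (tl Z l)
  | [] => .one
  | t :: l => .mul (w t) (Wd.tl w l)

lemma Wd.leaves_tl {V T : Type} {X : V → C} {Z : T → C} (w : ∀ t, Wd X (Z t)) (l : List T) :
    (Wd.tl w l).leaves = l.flatMap fun t => (w t).leaves := by
  induction l with
  | nil => rfl
  | cons t l ih => simp [Wd.tl, Wd.leaves, ih]

lemma Fm.ins {V T : Type} {X : V → C} {Z : T → C} (w : ∀ t, Wd X (Z t)) {t : T} {l l' : List T}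
    (i : Ins t l l') :
    Fm (fun v => v) (fun v => 𝟙 (X v)) (.mul (w t) (Wd.tl w l)) (Wd.tl w l') (i.interp Z) := by
  induction i with
  | here l => exact Fm.id _
  | there a i ih =>
    exact (Fm.swp (w t) (w a) _).comp (id_tensorHom (Z a) (i.interp Z) ▸ (Fm.id (w a)).mul ih)
      fun _ => Category.comp_id _

lemma Fm.tl {V V' T T' : Type} {X : V → C} {X' : V' → C} {Z : T → C} {Z' : T' → C}
    {σ : V → V'} {φ : ∀ v, X v ⟶ X' (σ v)} {τ : T → T'} {ψ : ∀ t, Z t ⟶ Z' (τ t)}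
    {w : ∀ t, Wd X (Z t)} {w' : ∀ t, Wd X' (Z' t)} (h : ∀ t, Fm σ φ (w t) (w' (τ t)) (ψ t))
    {l : List T} {l' : List T'} (p : Pm τ l l') :
    Fm σ φ (Wd.tl w l) (Wd.tl w' l') (p.interp ψ) := by
  induction p with
  | nil => exact Fm.one
  | cons t p i ih => exact ((h t).mul ih).comp (Fm.ins w' i) fun _ => Category.comp_id _

end Coherence

/-- A finite set, as an object of the category `Σ_*`. -/
structure FinBij : Type 1 where
  /-- the underlying set -/
  carrier : Type
  [fin : Finite carrier]

attribute [instance] FinBij.fin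

/-- `Σ_*`: the category of finite sets and bijections. -/
instance : Category.{0} FinBij where
  Hom S T := S.carrier ≃ T.carrier
  id S := Equiv.refl S.carrier
  comp f g := f.trans g

/-- An object of `Σ_* ≀ A`: a finite set with an object of `A` for each of its elements. -/
structure Wreath (A : Type u₁) : Type (max 1 u₁) where
  /-- the finite set -/
  idx : FinBij
  /-- the decorations -/
  lbl : idx.carrier → A

namespace Wreath

variable {A : Type u₁} [Category.{v₁} A] {B : Type u₂} [Category.{v₂} B]
  {D : Type u₃} [Category.{v₃} D]

/-- A morphism of `Σ_* ≀ A`: a bijection of the finite sets together with a morphism of `A`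
for each element. -/
structure Hom (x y : Wreath A) : Type v₁ where
  /-- the bijection -/
  σ : x.idx.carrier ≃ y.idx.carrier
  /-- the morphisms of decorations -/
  φ : ∀ s, x.lbl s ⟶ y.lbl (σ s)

lemma Hom.ext' {x y : Wreath A} {f g : Hom x y} (h : ∀ s, f.σ s = g.σ s)
    (h' : ∀ s, f.φ s ≫ eqToHom (congrArg y.lbl (h s)) = g.φ s) : f = g := by
  obtain ⟨σ, φ⟩ := f
  obtain ⟨τ, ψ⟩ := g
  obtain rfl : σ = τ := Equiv.ext h
  obtain rfl : φ = ψ := funext fun s => by simpa using h' s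
  rfl

lemma Hom.congr {x y : Wreath A} (σ : x.idx.carrier ≃ y.idx.carrier)
    {φ ψ : ∀ s, x.lbl s ⟶ y.lbl (σ s)} (h : ∀ s, φ s = ψ s) : Hom.mk σ φ = Hom.mk σ ψ :=
  congrArg _ (funext h)

instance : Category.{v₁} (Wreath A) where
  Hom := Hom
  id x := ⟨Equiv.refl _, fun s => 𝟙 (x.lbl s)⟩
  comp f g := ⟨f.σ.trans g.σ, fun s => f.φ s ≫ g.φ (f.σ s)⟩
  id_comp _ := Hom.congr _ fun _ => Category.id_comp _
  comp_id _ := Hom.congr _ fun _ => Category.comp_id _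
  assoc _ _ _ := Hom.congr _ fun _ => Category.assoc _ _ _

variable (A) in
/-- The functor forgetting the decorations. -/
def forget : Wreath A ⥤ FinBij where
  obj x := x.idx
  map f := f.σ

/-- The functor `Σ_* ≀ F`. -/
def map (F : A ⥤ B) : Wreath A ⥤ Wreath B where
  obj x := ⟨x.idx, fun s => F.obj (x.lbl s)⟩
  map f := ⟨f.σ, fun s => F.map (f.φ s)⟩
  map_id _ := Hom.congr _ fun _ => F.map_id _
  map_comp _ _ := Hom.congr _ fun _ => F.map_comp _ _

/-- `Σ_* ≀ α` for a natural transformation `α`. -/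
def mapNat {F G : A ⥤ B} (α : F ⟶ G) : map F ⟶ map G where
  app x := ⟨Equiv.refl _, fun s => α.app (x.lbl s)⟩
  naturality _ _ f := Hom.ext' (fun _ => rfl) fun s =>
    (Category.comp_id _).trans (α.naturality (f.φ s))

/-- `Σ_* ≀ α` for a natural isomorphism `α`. -/
def mapNatIso {F G : A ⥤ B} (α : F ≅ G) : map F ≅ map G where
  hom := mapNat α.hom
  inv := mapNat α.inv
  hom_inv_id := NatTrans.ext (funext fun _ => Hom.ext' (fun _ => rfl) fun _ =>
    (Category.comp_id _).trans (α.hom_inv_id_app _))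
  inv_hom_id := NatTrans.ext (funext fun _ => Hom.ext' (fun _ => rfl) fun _ =>
    (Category.comp_id _).trans (α.inv_hom_id_app _))

variable (A) in
/-- The functor `γ² ≀ A : Σ_* ≀ (Σ_* ≀ A) ⥤ Σ_* ≀ A` taking a family of decorated sets to its
disjoint union. -/
def mu : Wreath (Wreath A) ⥤ Wreath A where
  obj x := ⟨⟨Σ t, (x.lbl t).idx.carrier⟩, fun s => (x.lbl s.1).lbl s.2⟩
  map f := ⟨Equiv.sigmaCongr f.σ fun t => (f.φ t).σ, fun s => (f.φ s.1).φ s.2⟩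
  map_id _ := Hom.ext' (fun _ => rfl) fun _ => Category.comp_id _
  map_comp _ _ := Hom.ext' (fun _ => rfl) fun _ => Category.comp_id _

/-- The one-element set decorated by `a`. -/
def unit (a : A) : Wreath A := ⟨⟨PUnit⟩, fun _ => a⟩

end Wreath

section Tensor

variable {C : Type u} [Category.{v} C] [MonoidalCategory C] [SymmetricCategory C]

/-- A chosen enumeration of a finite set. -/
noncomputable def enum (S : Type) [Finite S] : List S :=
  (@Finset.univ S (Fintype.ofFinite S)).toList

lemma enum_nodup (S : Type) [Finite S] : (enum S).Nodup := Finset.nodup_toList _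

lemma mem_enum {S : Type} [Finite S] (s : S) : s ∈ enum S := by simp [enum]

lemma enum_perm {S T : Type} [Finite S] [Finite T] (e : S ≃ T) :
    ((enum S).map e).Perm (enum T) :=
  (List.perm_ext_iff_of_nodup ((enum_nodup S).map e.injective) (enum_nodup T)).2 fun t =>
    ⟨fun _ => mem_enum t, fun _ => List.mem_map.2 ⟨e.symm t, mem_enum _, by simp⟩⟩

lemma Pm.interp_unique {V V' : Type} {X : V → C} {X' : V' → C} {σ : V → V'}
    {φ : ∀ v, X v ⟶ X' (σ v)} {l : List V} {l' : List V'} (p q : Pm σ l l') (h : l'.Nodup) :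
    p.interp φ = q.interp φ := by
  rw [p.unique q h]

variable (C) in
/-- The tensor product `⨂_{s ∈ S} X s` over a finite set, as a functor of the family. A bijection
of index sets acts by permuting the factors. -/
noncomputable def bigTensor : Wreath C ⥤ C where
  obj x := tl x.lbl (enum x.idx.carrier)
  map f := (Pm.exists (enum_perm f.σ)).some.interp f.φ
  map_id x := by
    obtain ⟨r, hr⟩ := Pm.refl x.lbl (enum x.idx.carrier)
    exact (Pm.interp_unique (φ := fun v => 𝟙 (x.lbl v)) _ r (enum_nodup _)).trans hr
  map_comp f g := by
    obtain ⟨r, hr⟩ := Pm.comp (φ := f.φ) (ψ := g.φ) (Pm.exists (enum_perm f.σ)).some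
      (Pm.exists (enum_perm g.σ)).some
    exact (Pm.interp_unique (φ := fun v => f.φ v ≫ g.φ (f.σ v)) _ r (enum_nodup _)).trans hr.symm

lemma Fm.bigTensor {V V' : Type} {X : V → C} {X' : V' → C} {σ : V → V'} {φ : ∀ v, X v ⟶ X' (σ v)}
    {x y : Wreath C} {w : ∀ s, Wd X (x.lbl s)} {w' : ∀ s, Wd X' (y.lbl s)} (f : x ⟶ y)
    (h : ∀ s, Fm σ φ (w s) (w' (f.σ s)) (f.φ s)) :
    Fm σ φ (Wd.tl w (enum x.idx.carrier)) (Wd.tl w' (enum y.idx.carrier))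
      ((bigTensor C).map f) :=
  Fm.tl h _

section Distr

variable {T : Type} [Finite T] (g : T → C) (L : T → Wreath C)

/-- The factors occurring in `⨂ t, (g t ⊗ ⨂ s, (L t) s)`. -/
def distrLbl : T ⊕ (Σ t, (L t).idx.carrier) → C
  | .inl t => g t
  | .inr s => (L s.1).lbl s.2

/-- The bracketing `(⨂ t, g t) ⊗ ⨂ (t, s), (L t) s`. -/
noncomputable def distrSrc :
    Wd (distrLbl g L) (tl g (enum T) ⊗
      tl (fun s : Σ t, (L t).idx.carrier => (L s.1).lbl s.2) (enum _)) :=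
  .mul (Wd.tl (X := distrLbl g L) (fun t => .of (.inl t)) _)
    (Wd.tl (X := distrLbl g L) (fun s => .of (.inr s)) _)

/-- The bracketing `⨂ t, (g t ⊗ ⨂ s, (L t) s)`. -/
noncomputable def distrTgt :
    Wd (distrLbl g L) (tl (fun t => g t ⊗ (bigTensor C).obj (L t)) (enum T)) :=
  Wd.tl (X := distrLbl g L) (fun t => .mul (.of (.inl t))
    (Wd.tl (X := distrLbl g L) (fun s => .of (.inr ⟨t, s⟩)) _)) _

lemma distrSrc_leaves :
    (distrSrc g L).leaves = (enum T).map .inl ++ (enum (Σ t, (L t).idx.carrier)).map .inr :=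
  congrArg₂ (· ++ ·) ((Wd.leaves_tl _ _).trans (List.flatMap_pure_eq_map _ _))
    ((Wd.leaves_tl _ _).trans (List.flatMap_pure_eq_map _ _))

lemma distrTgt_leaves :
    (distrTgt g L).leaves = (enum T).flatMap fun t =>
      .inl t :: (enum (L t).idx.carrier).map fun s => .inr ⟨t, s⟩ :=
  (Wd.leaves_tl _ _).trans (congrArg (fun h => (enum T).flatMap h) (funext fun _ =>
    congrArg (List.cons _) ((Wd.leaves_tl _ _).trans (List.flatMap_pure_eq_map _ _))))

lemma distrSrc_nodup : (distrSrc g L).leaves.Nodup := by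
  rw [distrSrc_leaves]
  refine List.Nodup.append ((enum_nodup _).map Sum.inl_injective)
    ((enum_nodup _).map Sum.inr_injective) ?_
  simp [List.Disjoint]

lemma distrTgt_nodup : (distrTgt g L).leaves.Nodup := by
  rw [distrTgt_leaves, List.nodup_flatMap]
  refine ⟨fun t _ => List.nodup_cons.2 ⟨by simp, (enum_nodup _).map ?_⟩, ?_⟩
  · intro s s' h
    simpa using h
  · refine (enum_nodup T).imp fun {t t'} h => ?_
    simp only [Function.onFun, List.Disjoint]
    intro v hv hv'
    cases v <;> simp_all
    grind

lemma distr_perm : ((distrSrc g L).leaves.map fun v => v).Perm (distrTgt g L).leaves := by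
  rw [List.map_id']
  refine (List.perm_ext_iff_of_nodup (distrSrc_nodup g L) (distrTgt_nodup g L)).2 fun v => ?_
  rw [distrSrc_leaves, distrTgt_leaves]
  rcases v with t | ⟨t, s⟩ <;> simp [mem_enum]

/-- The canonical rearrangement
`(⨂ t, g t) ⊗ ⨂ (t, s), (L t) s ⟶ ⨂ t, (g t ⊗ ⨂ s, (L t) s)`. -/
noncomputable def distrApp :
    tl g (enum T) ⊗ tl (fun s : Σ t, (L t).idx.carrier => (L s.1).lbl s.2) (enum _) ⟶
      tl (fun t => g t ⊗ (bigTensor C).obj (L t)) (enum T) :=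
  (Fm.exists (σ := fun v => v) (φ := fun v => 𝟙 (distrLbl g L v)) (distrSrc g L) (distrTgt g L)
    (distr_perm g L)).choose

lemma distrApp_fm :
    Fm (fun v => v) (fun v => 𝟙 (distrLbl g L v)) (distrSrc g L) (distrTgt g L) (distrApp g L) :=
  (Fm.exists (σ := fun v => v) (φ := fun v => 𝟙 (distrLbl g L v)) (distrSrc g L) (distrTgt g L)
    (distr_perm g L)).choose_spec

end Distr

/-- The rearrangement `(⨂ t, G e_t) ⊗ ⨂ (t, s), (L e_t) s ⟶ ⨂ t, (G e_t ⊗ ⨂ s, (L e_t) s)`,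
natural in the family `e`. -/
noncomputable def distr {A : Type u₁} [Category.{v₁} A] (G : A ⥤ C) (L : A ⥤ Wreath C) :
    (Wreath.map G ⋙ bigTensor C) ⊗ (Wreath.map L ⋙ Wreath.mu C ⋙ bigTensor C) ⟶
      Wreath.map (G ⊗ (L ⋙ bigTensor C)) ⋙ bigTensor C where
  app x := distrApp (fun t => G.obj (x.lbl t)) (fun t => L.obj (x.lbl t))
  naturality x y f := by
    let X := distrLbl (fun t => G.obj (x.lbl t)) (fun t => L.obj (x.lbl t))
    let Y := distrLbl (fun t => G.obj (y.lbl t)) (fun t => L.obj (y.lbl t))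
    let σ : x.idx.carrier ⊕ (Σ t, (L.obj (x.lbl t)).idx.carrier) →
        y.idx.carrier ⊕ (Σ t, (L.obj (y.lbl t)).idx.carrier) :=
      Sum.map f.σ (fun s => ⟨f.σ s.1, (L.map (f.φ s.1)).σ s.2⟩)
    let φ : ∀ v, X v ⟶ Y (σ v) := fun v => match v with
      | .inl t => G.map (f.φ t)
      | .inr s => (L.map (f.φ s.1)).φ s.2
    refine Fm.unique (σ := σ) (φ := φ) (w := distrSrc _ _) (w' := distrTgt _ _) ?_ ?_
      (distrTgt_nodup _ _)
    · refine Fm.comp (σ := σ) (φ := φ) (w' := distrSrc _ _) ?_ (distrApp_fm _ _)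
        fun _ => Category.comp_id _
      exact Fm.mul (Fm.bigTensor ((Wreath.map G).map f) fun t => Fm.of (σ := σ) (φ := φ) (.inl t))
        (Fm.bigTensor ((Wreath.map L ⋙ Wreath.mu C).map f)
          fun s => Fm.of (σ := σ) (φ := φ) (.inr s))
    · refine Fm.comp (τ := σ) (ψ := φ) (w' := distrTgt _ _) (distrApp_fm _ _) ?_
        fun _ => Category.id_comp _
      exact Fm.bigTensor ((Wreath.map (G ⊗ (L ⋙ bigTensor C))).map f) fun t =>
        Fm.mul (Fm.of (σ := σ) (φ := φ) (.inl t))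
          (Fm.bigTensor (L.map (f.φ t)) fun s => Fm.of (σ := σ) (φ := φ) (.inr ⟨t, s⟩))

end Tensor

/-- The functor `γ² : Σ_* ≀ Σ_* ⥤ Σ_*` taking a family of finite sets to its disjoint union. -/
def gammaTwo : Wreath FinBij ⥤ FinBij where
  obj x := ⟨Σ t, (x.lbl t).carrier⟩
  map f := Equiv.sigmaCongr f.σ f.φ
  map_id _ := Equiv.ext fun _ => rfl
  map_comp _ _ := Equiv.ext fun _ => rfl

/-- `Σ_0`: the category of empty sets and bijections. -/
structure EmptyBij : Type 1 where
  /-- the underlying finite set -/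
  set : FinBij
  [isEmpty : IsEmpty set.carrier]

attribute [instance] EmptyBij.isEmpty

instance : Category.{0} EmptyBij where
  Hom S T := S.set ⟶ T.set
  id S := 𝟙 S.set
  comp f g := f ≫ g

/-- The functor `Σ_* ≀ Σ_0 ⥤ Σ_0` taking a family of empty sets to its disjoint union. -/
def gammaTwoZero : Wreath EmptyBij ⥤ EmptyBij where
  obj x :=
    have : IsEmpty (Σ t, (x.lbl t).set.carrier) := ⟨fun s => isEmptyElim s.2⟩
    { set := ⟨Σ t, (x.lbl t).set.carrier⟩ }
  map f := Equiv.sigmaCongr f.σ f.φ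
  map_id _ := Equiv.ext fun _ => rfl
  map_comp _ _ := Equiv.ext fun _ => rfl

/-- An isomorphism of `Σ_*` from a bijection. -/
def isoOfEquiv {S T : FinBij} (e : S.carrier ≃ T.carrier) : S ≅ T where
  hom := e
  inv := e.symm
  hom_inv_id := Equiv.self_trans_symm e
  inv_hom_id := Equiv.symm_trans_self e

/-- An isomorphism of `Σ_0` from a bijection. -/
def isoOfEquivZero {S T : EmptyBij} (e : S.set.carrier ≃ T.set.carrier) : S ≅ T where
  hom := e
  inv := e.symm
  hom_inv_id := Equiv.self_trans_symm e
  inv_hom_id := Equiv.symm_trans_self e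

instance : EssentiallySmall.{0} FinBij := by
  refine (essentiallySmall_iff _).2 ⟨small_of_surjective (α := ℕ)
    (f := fun n => toSkeleton (⟨Fin n⟩ : FinBij)) fun X => ?_, inferInstance⟩
  obtain ⟨S, rfl⟩ := Quotient.exists_rep X
  obtain ⟨n, ⟨e⟩⟩ := Finite.exists_equiv_fin S.carrier
  exact ⟨n, Quotient.sound ⟨isoOfEquiv e.symm⟩⟩

instance : EssentiallySmall.{0} EmptyBij := by
  refine (essentiallySmall_iff _).2 ⟨small_of_surjective (α := PUnit.{1})
    (f := fun _ => toSkeleton ({ set := ⟨PEmpty⟩ } : EmptyBij)) fun X => ?_, inferInstance⟩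
  obtain ⟨S, rfl⟩ := Quotient.exists_rep X
  exact ⟨⟨⟩, Quotient.sound ⟨isoOfEquivZero (Equiv.equivOfIsEmpty _ _)⟩⟩

/-- The categories over which Kan extensions are formed. There are two of them, `Base.sigma`
(for comodules) and `Base.zero` (for coalgebras); the structure only serves to treat both at once. -/
structure Base where
  /-- the category `Σ_*` or `Σ_0` -/
  B : Type 1
  [cat : Category.{0} B]
  [small : EssentiallySmall.{0} B]
  /-- disjoint unions of families -/
  act : Wreath B ⥤ B
  /-- `γ² s₀ ≅ id` -/
  unitIso (b : B) : act.obj (Wreath.unit b) ≅ b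
  /-- associativity of disjoint unions, `γ² (γ² ≀ id) ≅ γ² (id ≀ γ²)` -/
  assocIso : Wreath.mu B ⋙ act ≅ Wreath.map act ⋙ act

attribute [instance] Base.cat Base.small

/-- The base `Σ_*`. -/
abbrev Base.sigma : Base where
  B := FinBij
  act := gammaTwo
  unitIso b := isoOfEquiv (Equiv.uniqueSigma fun _ : PUnit => b.carrier)
  assocIso := NatIso.ofComponents
    (fun x => isoOfEquiv (Equiv.sigmaAssoc fun t s => ((x.lbl t).lbl s).carrier))
    fun _ => Equiv.ext fun _ => rfl

/-- The base `Σ_0`. -/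
abbrev Base.zero : Base where
  B := EmptyBij
  act := gammaTwoZero
  unitIso b := isoOfEquivZero (Equiv.uniqueSigma fun _ : PUnit => b.set.carrier)
  assocIso := NatIso.ofComponents
    (fun x => isoOfEquivZero (Equiv.sigmaAssoc fun t s => ((x.lbl t).lbl s).set.carrier))
    fun _ => Equiv.ext fun _ => rfl

section Pull

variable {E : Type u₁} [Category.{v₁} E] {F : Type u₂} [Category.{v₂} F]

/-- An object of the wreath product `E ≀ F`, where `p : E ⥤ Σ_*` assigns to each object of `E` its
set of leaves: an object of `E` whose leaves are decorated by objects of `F`. -/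
structure Pull (p : E ⥤ FinBij) (F : Type u₂) : Type (max u₁ u₂) where
  /-- the object of `E` -/
  tree : E
  /-- the decorations of the leaves -/
  lbl : (p.obj tree).carrier → F

/-- The leaves with their decorations. -/
def Pull.wreath {p : E ⥤ FinBij} (x : Pull p F) : Wreath F := ⟨p.obj x.tree, x.lbl⟩

/-- A morphism of `E ≀ F`: a morphism of `E` and compatible morphisms of the decorations. -/
@[ext]
structure Pull.Hom {p : E ⥤ FinBij} (x y : Pull p F) : Type (max v₁ v₂) where
  /-- the morphism of `E` -/
  tree : x.tree ⟶ y.tree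
  /-- the morphism of decorated leaves -/
  leaf : x.wreath ⟶ y.wreath
  /-- compatibility on leaves -/
  comm : leaf.σ = p.map tree

instance (p : E ⥤ FinBij) : Category.{max v₁ v₂} (Pull p F) where
  Hom := Pull.Hom
  id x := ⟨𝟙 _, 𝟙 _, (p.map_id x.tree).symm⟩
  comp f g := ⟨f.tree ≫ g.tree, f.leaf ≫ g.leaf, by
    rw [p.map_comp, ← f.comm, ← g.comm]; rfl⟩
  id_comp _ := Pull.Hom.ext (Category.id_comp _) (Category.id_comp _)
  comp_id _ := Pull.Hom.ext (Category.comp_id _) (Category.comp_id _)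
  assoc _ _ _ := Pull.Hom.ext (Category.assoc _ _ _) (Category.assoc _ _ _)

/-- Forgetting the decorations. -/
def Pull.fst (p : E ⥤ FinBij) (F : Type u₂) [Category.{v₂} F] : Pull p F ⥤ E where
  obj x := x.tree
  map f := f.tree

/-- The decorated set of leaves. -/
def Pull.snd (p : E ⥤ FinBij) (F : Type u₂) [Category.{v₂} F] : Pull p F ⥤ Wreath F where
  obj x := x.wreath
  map f := f.leaf

/-- The decorated set of leaves is the set of leaves of the tree. -/
def Pull.sq (p : E ⥤ FinBij) (F : Type u₂) [Category.{v₂} F] :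
    Pull.snd p F ⋙ Wreath.forget F ≅ Pull.fst p F ⋙ p :=
  NatIso.ofComponents (fun x => Iso.refl (p.obj x.tree)) fun f =>
    (Category.comp_id _).trans (f.comm.trans (Category.id_comp _).symm)

end Pull

section Small

variable {E : Type u₁} [Category.{0} E] [EssentiallySmall.{0} E]
  {F : Type u₂} [Category.{0} F] [EssentiallySmall.{0} F]

/-- A bijection covered by isomorphisms of decorations is an isomorphism. -/
def wreathIso {x y : Wreath F} (e : x.idx.carrier ≃ y.idx.carrier)
    (i : ∀ s, x.lbl s ≅ y.lbl (e s)) : x ≅ y where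
  hom := ⟨e, fun s => (i s).hom⟩
  inv := ⟨e.symm, fun t => eqToHom (congrArg y.lbl (e.apply_symm_apply t).symm) ≫
    (i (e.symm t)).inv⟩
  hom_inv_id := Wreath.Hom.ext' (fun s => e.symm_apply_apply s) fun s => by
    have key : ∀ (s' : x.idx.carrier) (h : s' = s) (h₁ : y.lbl (e s) = y.lbl (e s'))
        (h₂ : x.lbl s' = x.lbl s),
        ((i s).hom ≫ eqToHom h₁ ≫ (i s').inv) ≫ eqToHom h₂ = 𝟙 _ := by
      rintro s' rfl h₁ h₂
      simp
    exact key _ (e.symm_apply_apply s) _ _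
  inv_hom_id := Wreath.Hom.ext' (fun t => e.apply_symm_apply t) fun t => by
    have key : ∀ (s : x.idx.carrier) (h₁ : y.lbl t = y.lbl (e s)) (h₂ : y.lbl (e s) = y.lbl t),
        ((eqToHom h₁ ≫ (i s).inv) ≫ (i s).hom) ≫ eqToHom h₂ = 𝟙 _ := by
      intro s h₁ h₂
      simp
    exact key _ _ _

instance : EssentiallySmall.{0} (Wreath F) := by
  refine (essentiallySmall_iff _).2 ⟨small_of_surjective (α := Σ n : ℕ, (Fin n → Skeleton F))
    (f := fun k => toSkeleton (⟨⟨Fin k.1⟩, fun i => (fromSkeleton F).obj (k.2 i)⟩ : Wreath F))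
      fun X => ?_, inferInstance⟩
  obtain ⟨S, rfl⟩ := Quotient.exists_rep X
  obtain ⟨n, ⟨e⟩⟩ := Finite.exists_equiv_fin S.idx.carrier
  exact ⟨⟨n, fun i => toSkeleton (S.lbl (e.symm i))⟩, Quotient.sound
    ⟨wreathIso e.symm fun i => fromSkeletonToSkeletonIso _⟩⟩

/-- Isomorphisms of `E ≀ F` from isomorphisms of the two components. -/
def pullIso {p : E ⥤ FinBij} {x y : Pull p F} (i : x.tree ≅ y.tree) (w : x.wreath ≅ y.wreath)
    (h : w.hom.σ = p.map i.hom) : x ≅ y where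
  hom := ⟨i.hom, w.hom, h⟩
  inv := ⟨i.inv, w.inv, by
    have h₁ : ((Wreath.forget F).mapIso w).hom = (p.mapIso i).hom := h
    exact congrArg Iso.inv (Iso.ext h₁)⟩
  hom_inv_id := Pull.Hom.ext i.hom_inv_id w.hom_inv_id
  inv_hom_id := Pull.Hom.ext i.inv_hom_id w.inv_hom_id

instance (p : E ⥤ FinBij) : EssentiallySmall.{0} (Pull p F) := by
  refine (essentiallySmall_iff _).2 ⟨small_of_surjective
    (α := Σ k : Skeleton E, ((p.obj ((fromSkeleton E).obj k)).carrier → Skeleton F))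
    (f := fun k => toSkeleton
      (⟨(fromSkeleton E).obj k.1, fun i => (fromSkeleton F).obj (k.2 i)⟩ : Pull p F))
      fun X => ?_, inferInstance⟩
  obtain ⟨S, rfl⟩ := Quotient.exists_rep X
  let i := fromSkeletonToSkeletonIso S.tree
  let e : (p.obj ((fromSkeleton E).obj (toSkeleton S.tree))).carrier ≃ (p.obj S.tree).carrier :=
    p.map i.hom
  exact ⟨⟨toSkeleton S.tree, fun s => toSkeleton (S.lbl (e s))⟩, Quotient.sound
    ⟨pullIso i (wreathIso e fun s => fromSkeletonToSkeletonIso _) rfl⟩⟩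

end Small

section Cells

variable {C : Type u} [Category.{v} C]

/-- A functor `Y : E ⥤ C` out of a category of trees, together with the functor `p` which
contracts a tree to its set of leaves and along which right Kan extensions are taken. -/
structure Cell (𝔹 : Base) (C : Type u) [Category.{v} C] where
  /-- the category of trees -/
  E : Type 1
  [cat : Category.{0} E]
  [small : EssentiallySmall.{0} E]
  /-- the set of leaves of a tree -/
  p : E ⥤ 𝔹.B
  /-- the functor to extend -/
  Y : E ⥤ C

attribute [instance] Cell.cat Cell.small

namespace Cell

variable {𝔹 : Base}

instance (𝒳 : Cell 𝔹 C) [HasLimitsOfSize.{0, 0} C] : 𝒳.p.HasRightKanExtension 𝒳.Y := by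
  have : ∀ b, HasLimitsOfShape (StructuredArrow b 𝒳.p) C := fun b =>
    hasLimitsOfShape_of_essentiallySmall.{0} _ _
  infer_instance

/-- The right Kan extension of `Y` along `p`. -/
noncomputable def hat [HasLimitsOfSize.{0, 0} C] (𝒳 : Cell 𝔹 C) : 𝔹.B ⥤ C :=
  𝒳.p.rightKanExtension 𝒳.Y

/-- The universal transformation `ι`. -/
noncomputable def ι [HasLimitsOfSize.{0, 0} C] (𝒳 : Cell 𝔹 C) : 𝒳.p ⋙ 𝒳.hat ⟶ 𝒳.Y :=
  𝒳.p.rightKanExtensionCounit 𝒳.Y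

/-- The transformation of functors over `𝔹.B` induced by a transformation over the trees. -/
noncomputable def lift [HasLimitsOfSize.{0, 0} C] (𝒳 : Cell 𝔹 C) {G : 𝔹.B ⥤ C}
    (α : 𝒳.p ⋙ G ⟶ 𝒳.Y) : G ⟶ 𝒳.hat :=
  (𝒳.p.rightKanExtension 𝒳.Y).liftOfIsRightKanExtension
    (𝒳.p.rightKanExtensionCounit 𝒳.Y) G α

/-- A functor `q` between categories of trees which preserves leaves (this is `θ`), together with a
transformation `τ : 𝒳.Y q ⟶ 𝒴.Y`. -/
structure Hom (𝒳 𝒴 : Cell 𝔹 C) where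
  /-- the functor on trees -/
  q : 𝒴.E ⥤ 𝒳.E
  /-- preservation of leaves -/
  θ : q ⋙ 𝒳.p ≅ 𝒴.p
  /-- the transformation -/
  τ : q ⋙ 𝒳.Y ⟶ 𝒴.Y

/-- The identity. -/
def Hom.id (𝒳 : Cell 𝔹 C) : Hom 𝒳 𝒳 := ⟨𝟭 _, 𝒳.p.leftUnitor, 𝒳.Y.leftUnitor.hom⟩

/-- Composition. -/
def Hom.comp {𝒳 𝒴 𝒵 : Cell 𝔹 C} (h : Hom 𝒳 𝒴) (k : Hom 𝒴 𝒵) : Hom 𝒳 𝒵 where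
  q := k.q ⋙ h.q
  θ := Functor.associator _ _ _ ≪≫ Functor.isoWhiskerLeft k.q h.θ ≪≫ k.θ
  τ := (Functor.associator _ _ _).hom ≫ Functor.whiskerLeft k.q h.τ ≫ k.τ

/-- Restriction of a transformation `α : G p ⟶ 𝒳.Y` along `q`, followed by `τ`. -/
def Hom.push {𝒳 𝒴 : Cell 𝔹 C} (h : Hom 𝒳 𝒴) {G : 𝔹.B ⥤ C} (α : 𝒳.p ⋙ G ⟶ 𝒳.Y) :
    𝒴.p ⋙ G ⟶ 𝒴.Y :=
  Functor.whiskerRight h.θ.inv G ≫ (Functor.associator _ _ _).hom ≫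
    Functor.whiskerLeft h.q α ≫ h.τ

/-- The induced transformation of right Kan extensions. -/
noncomputable def Hom.hat [HasLimitsOfSize.{0, 0} C] {𝒳 𝒴 : Cell 𝔹 C} (h : Hom 𝒳 𝒴) :
    𝒳.hat ⟶ 𝒴.hat :=
  𝒴.lift (h.push 𝒳.ι)

/-- A functor over `𝔹.B`, as a functor on trees of level one. -/
def base (M : 𝔹.B ⥤ C) : Cell 𝔹 C where
  E := 𝔹.B
  p := 𝟭 _
  Y := M

/-- A transformation, as a morphism of functors on trees of level one. -/
def Hom.base {M N : 𝔹.B ⥤ C} (f : M ⟶ N) : Hom (Cell.base M) (Cell.base N) :=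
  ⟨𝟭 _, (𝟭 _).leftUnitor, M.leftUnitor.hom ≫ f⟩

/-- A transformation `G p ⟶ 𝒳.Y`, as a morphism. -/
def Hom.ofTrans {G : 𝔹.B ⥤ C} {𝒳 : Cell 𝔹 C} (α : 𝒳.p ⋙ G ⟶ 𝒳.Y) : Hom (Cell.base G) 𝒳 :=
  ⟨𝒳.p, 𝒳.p.rightUnitor, α⟩

variable [MonoidalCategory C] [SymmetricCategory C]

/-- The functor `A ⊚ 𝒴 : Σ_* ≀ E ⥤ C`, which takes a set `T` decorated by trees `t_s` to
`A(T) ⊗ ⨂ s, 𝒴(t_s)`. -/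
noncomputable def circ (A : FinBij ⥤ C) (𝒴 : Cell 𝔹 C) : Cell 𝔹 C where
  E := Wreath 𝒴.E
  p := Wreath.map 𝒴.p ⋙ 𝔹.act
  Y := (Wreath.forget 𝒴.E ⋙ A) ⊗ (Wreath.map 𝒴.Y ⋙ bigTensor C)

/-- Functoriality of `⊚`. -/
noncomputable def Hom.circ {A A' : FinBij ⥤ C} (f : A ⟶ A') {𝒴 𝒴' : Cell 𝔹 C} (h : Hom 𝒴 𝒴') :
    Hom (Cell.circ A 𝒴) (Cell.circ A' 𝒴') where
  q := Wreath.map h.q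
  θ := Functor.isoWhiskerRight (Wreath.mapNatIso h.θ) 𝔹.act
  τ := Functor.whiskerLeft (Wreath.forget 𝒴'.E) f ⊗ₘ
    Functor.whiskerRight (Wreath.mapNat h.τ) (bigTensor C)

/-- The functor `𝒳 ⊚ 𝒴 : E ≀ F ⥤ C`, which takes a tree `t` with leaves decorated by trees `t_s`
to `𝒳(t) ⊗ ⨂ s, 𝒴(t_s)`. -/
noncomputable def odot (𝒳 : Cell Base.sigma C) (𝒴 : Cell 𝔹 C) : Cell 𝔹 C where
  E := Pull 𝒳.p 𝒴.E
  p := Pull.snd 𝒳.p 𝒴.E ⋙ Wreath.map 𝒴.p ⋙ 𝔹.act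
  Y := (Pull.fst 𝒳.p 𝒴.E ⋙ 𝒳.Y) ⊗ (Pull.snd 𝒳.p 𝒴.E ⋙ Wreath.map 𝒴.Y ⋙ bigTensor C)

/-- The morphism `R ⊚ 𝒴 ⟶ 𝒳 ⊚ 𝒴` given by a transformation `R p ⟶ 𝒳.Y`. -/
noncomputable def split {R : FinBij ⥤ C} {𝒳 : Cell Base.sigma C} (ρ : 𝒳.p ⋙ R ⟶ 𝒳.Y)
    (𝒴 : Cell 𝔹 C) : Hom (circ R 𝒴) (odot 𝒳 𝒴) where
  q := Pull.snd 𝒳.p 𝒴.E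
  θ := Iso.refl _
  τ := ((Functor.whiskerRight (Pull.sq 𝒳.p 𝒴.E).hom R ≫
      Functor.whiskerLeft (Pull.fst 𝒳.p 𝒴.E) ρ) ⊗ₘ
    𝟙 (Pull.snd 𝒳.p 𝒴.E ⋙ Wreath.map 𝒴.Y ⋙ bigTensor C) :)

/-- The identification of `A ⊚ 𝒴`, for `A` seen as a functor on trees of level one, with `A ⊚ 𝒴`. -/
noncomputable def collapse (A : FinBij ⥤ C) (𝒴 : Cell 𝔹 C) :
    Hom (odot (base (𝔹 := Base.sigma) A) 𝒴) (circ A 𝒴) where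
  q := { obj := fun x => ⟨x.idx, x.lbl⟩
         map := fun f => ⟨f.σ, f, rfl⟩ }
  θ := Iso.refl _
  τ := 𝟙 _

/-- The associativity `(A ⊚ 𝒳) ⊚ 𝒴 ⟶ A ⊚ (𝒳 ⊚ 𝒴)` of `⊚`. -/
noncomputable def assoc (A : FinBij ⥤ C) (𝒳 : Cell Base.sigma C) (𝒴 : Cell 𝔹 C) :
    Hom (odot (circ A 𝒳) 𝒴) (circ A (odot 𝒳 𝒴)) where
  q := { obj := fun x => ⟨⟨x.idx, fun t => (x.lbl t).tree⟩, fun s => (x.lbl s.1).lbl s.2⟩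
         map := fun f => ⟨⟨f.σ, fun t => (f.φ t).tree⟩,
           (Wreath.mu 𝒴.E).map ((Wreath.map (Pull.snd 𝒳.p 𝒴.E)).map f),
           congrArg (Equiv.sigmaCongr f.σ) (funext fun t => (f.φ t).comm)⟩
         map_id := fun x => Pull.Hom.ext (by rfl)
           ((Wreath.map (Pull.snd 𝒳.p 𝒴.E) ⋙ Wreath.mu 𝒴.E).map_id x)
         map_comp := fun f g => Pull.Hom.ext (by rfl)
           ((Wreath.map (Pull.snd 𝒳.p 𝒴.E) ⋙ Wreath.mu 𝒴.E).map_comp f g) }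
  θ := Functor.isoWhiskerLeft
    (Wreath.map (Pull.snd 𝒳.p 𝒴.E) ⋙ Wreath.map (Wreath.map 𝒴.p)) 𝔹.assocIso
  τ := ((α_ (Wreath.forget (Pull 𝒳.p 𝒴.E) ⋙ A)
      (Wreath.map (Pull.fst 𝒳.p 𝒴.E ⋙ 𝒳.Y) ⋙ bigTensor C)
      (Wreath.map (Pull.snd 𝒳.p 𝒴.E ⋙ Wreath.map 𝒴.Y) ⋙ Wreath.mu C ⋙ bigTensor C)).hom ≫
    ((Wreath.forget (Pull 𝒳.p 𝒴.E) ⋙ A) ◁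
      distr (Pull.fst 𝒳.p 𝒴.E ⋙ 𝒳.Y) (Pull.snd 𝒳.p 𝒴.E ⋙ Wreath.map 𝒴.Y)) :)

end Cell
end Cells

section Cooperads

variable {C : Type u} [Category.{v} C] [MonoidalCategory C] [SymmetricCategory C]

lemma enum_punit : enum PUnit.{1} = [PUnit.unit] :=
  List.perm_singleton.1 ((List.perm_ext_iff_of_nodup (enum_nodup _) (List.nodup_singleton _)).2
    fun _ => ⟨fun _ => List.mem_singleton.2 rfl, fun _ => mem_enum _⟩)

/-- A tensor product with one factor `a` is `a`. -/
noncomputable def unitTensor (a : C) : (bigTensor C).obj (Wreath.unit a) ⟶ a :=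
  eqToHom (congrArg (tl fun _ : PUnit.{1} => a) enum_punit) ≫ (ρ_ a).hom

/-- A tensor product of units is the unit. -/
noncomputable def tensorUnits {S : Type} {X : S → C} (f : ∀ s, X s ⟶ 𝟙_ C) :
    ∀ l : List S, tl X l ⟶ 𝟙_ C
  | [] => 𝟙 _
  | s :: l => (f s ⊗ₘ tensorUnits f l) ≫ (λ_ (𝟙_ C)).hom

lemma FinBij.card_eq {S T : FinBij} (f : S ⟶ T) : Nat.card S.carrier = Nat.card T.carrier :=
  Nat.card_congr f

variable (C) in
open Classical in
/-- The counit symmetric sequence: the unit object on one-element sets and the terminal object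
on all other sets. -/
noncomputable def counitSeq [HasTerminal C] : FinBij ⥤ C where
  obj T := if Nat.card T.carrier = 1 then 𝟙_ C else ⊤_ C
  map f := eqToHom (by rw [FinBij.card_eq f])

/-- The value of the counit symmetric sequence on a one-element set. -/
noncomputable def counitSeqUnit [HasTerminal C] : (counitSeq C).obj ⟨PUnit⟩ ⟶ 𝟙_ C :=
  eqToHom (if_pos Nat.card_unique)

open Cell

/-- The transformation which applies `Δ` to the first factor of `A ⊚ 𝒴`. -/
noncomputable def coface {A : FinBij ⥤ C}
    (Δ : (circ A (base (𝔹 := Base.sigma) A)).p ⋙ A ⟶ (circ A (base (𝔹 := Base.sigma) A)).Y)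
    {𝔹 : Base} (𝒴 : Cell 𝔹 C) : Hom (circ A 𝒴) (circ A (circ A 𝒴)) :=
  ((split Δ 𝒴).comp (assoc A (base (𝔹 := Base.sigma) A) 𝒴)).comp
    (Hom.circ (𝟙 A) (collapse A 𝒴))

/-- The composite `M(b) ⟶ A(⋆) ⊗ M(b) ⟶ 𝟙(⋆) ⊗ M(b) ⟶ M(b)` of a cocomposition with the counit
of `A`. -/
noncomputable def counitLeft [HasTerminal C] {A : FinBij ⥤ C} (ε : A ⟶ counitSeq C) {𝔹 : Base}
    {M : 𝔹.B ⥤ C} (Δ : (circ A (base M)).p ⋙ M ⟶ (circ A (base M)).Y) (b : 𝔹.B) :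
    M.obj b ⟶ M.obj b :=
  M.map (𝔹.unitIso b).inv ≫ Δ.app (Wreath.unit b) ≫
    ((ε.app ⟨PUnit⟩ ≫ counitSeqUnit) ⊗ₘ unitTensor (M.obj b)) ≫ (λ_ (M.obj b)).hom

/-- The composite `A(S) ⟶ A(S) ⊗ ⨂ s, A(⋆) ⟶ A(S) ⊗ ⨂ s, 𝟙(⋆) ⟶ A(S)`. -/
noncomputable def counitRight [HasTerminal C] {A : FinBij ⥤ C} (ε : A ⟶ counitSeq C)
    (Δ : (circ A (base (𝔹 := Base.sigma) A)).p ⋙ A ⟶ (circ A (base (𝔹 := Base.sigma) A)).Y)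
    (S : FinBij) : A.obj S ⟶ A.obj S :=
  A.map (isoOfEquiv (T := ⟨Σ _ : S.carrier, PUnit⟩) (Equiv.sigmaPUnit S.carrier).symm).hom ≫
    Δ.app ⟨S, fun _ => ⟨PUnit⟩⟩ ≫
    (A.obj S ◁ tensorUnits (fun _ => ε.app ⟨PUnit⟩ ≫ counitSeqUnit) (enum S.carrier)) ≫
    (ρ_ (A.obj S)).hom

variable (C) in
/-- A counital cooperad `(A, Δ, ε)`. -/
structure Cooperad [HasTerminal C] where
  /-- the symmetric sequence -/
  A : FinBij ⥤ C
  /-- the cocomposition `A γ² ⟶ A ⊚ A` -/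
  Δ : (circ A (base (𝔹 := Base.sigma) A)).p ⋙ A ⟶ (circ A (base (𝔹 := Base.sigma) A)).Y
  /-- the counit -/
  ε : A ⟶ counitSeq C
  coassoc : (coface Δ (base (𝔹 := Base.sigma) A)).push Δ =
    (Hom.circ (𝟙 A) (Hom.ofTrans Δ)).push Δ
  counit_left S : counitLeft (𝔹 := Base.sigma) ε Δ S = 𝟙 _
  counit_right S : counitRight ε Δ S = 𝟙 _

/-- A comodule `(M, Δ_M)` over a cooperad, where `M` is a functor on `Σ_*` or on `Σ_0`. -/
structure Comodule [HasTerminal C] (O : Cooperad C) (𝔹 : Base) where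
  /-- the functor -/
  M : 𝔹.B ⥤ C
  /-- the cocomposition `M γ² ⟶ O ⊚ M` -/
  Δ : (circ O.A (base M)).p ⋙ M ⟶ (circ O.A (base M)).Y
  coassoc : (coface O.Δ (base M)).push Δ = (Hom.circ (𝟙 O.A) (Hom.ofTrans Δ)).push Δ
  counit_left b : counitLeft O.ε Δ b = 𝟙 _

/-- A cooperad is a comodule over itself. -/
noncomputable def Cooperad.self [HasTerminal C] (O : Cooperad C) : Comodule O Base.sigma :=
  ⟨O.A, O.Δ, O.coassoc, O.counit_left⟩

end Cooperads

section Expressions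

open Cell

mutual

/-- A parenthesized composition product of copies of a cooperad `O` and a final comodule `M`. -/
inductive Expr
  /-- `O`, or `M` in the last position -/
  | atom : Expr
  /-- the composition product `(e ∘̂ w₁ ∘̂ ⋯ ∘̂ wₖ)` -/
  | node : Expr → Word → Expr

/-- The sequence `w₁ ∘̂ ⋯ ∘̂ wₖ` of the factors of a composition product, `k ≥ 1`. -/
inductive Word
  /-- a single factor -/
  | single : Expr → Word
  /-- one factor followed by others -/
  | cons : Expr → Word → Word

end

/-- Concatenation of sequences of factors. -/
def Word.append : Word → Word → Word
  | .single e, w => .cons e w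
  | .cons e v, w => .cons e (v.append w)

/-- The `k + 1` factors `O, …, O, M`. -/
def Word.flat : ℕ → Word
  | 0 => .single .atom
  | k + 1 => .cons .atom (Word.flat k)

/-- The expression `O^{∘̂ k} ∘̂ M` without inner parentheses; it is `M` for `k = 0`. -/
def Expr.flat : ℕ → Expr
  | 0 => .atom
  | k + 1 => .node .atom (Word.flat k)

variable {C : Type u} [Category.{v} C] [MonoidalCategory C] [SymmetricCategory C]
  [HasLimitsOfSize.{0, 0} C]

mutual

/-- The value of an expression, lifted to a larger universe. -/
noncomputable def Expr.evalAux (A : FinBij ⥤ C) :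
    Expr → ∀ {𝔹 : Base}, (𝔹.B ⥤ C) → ULift.{2} (𝔹.B ⥤ C)
  | .atom, _, M => ⟨M⟩
  | .node e w, _, M => ⟨(circ (e.evalAux A (𝔹 := Base.sigma) A).down (w.cell A M)).hat⟩

/-- The functor `w₁ ⊚ ⋯ ⊚ wₖ` on trees of level `k`. -/
noncomputable def Word.cell (A : FinBij ⥤ C) : Word → ∀ {𝔹 : Base}, (𝔹.B ⥤ C) → Cell 𝔹 C
  | .single e, _, M => base (e.evalAux A M).down
  | .cons e w, _, M => circ (e.evalAux A (𝔹 := Base.sigma) A).down (w.cell A M)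

end

/-- The value of an expression: `atom` is `M`, and `e ∘̂ w₁ ∘̂ ⋯ ∘̂ wₖ` is the right Kan extension
of `e ⊚ w₁ ⊚ ⋯ ⊚ wₖ`. All factors but the last are formed from `A`, the last one from `M`. -/
noncomputable def Expr.eval (A : FinBij ⥤ C) (e : Expr) {𝔹 : Base} (M : 𝔹.B ⥤ C) : 𝔹.B ⥤ C :=
  (e.evalAux A M).down

/-- The associativity `(w'₁ ⊚ ⋯ ⊚ w'ⱼ) ⊚ (w₁ ⊚ ⋯ ⊚ wₖ) ⟶ w'₁ ⊚ ⋯ ⊚ w'ⱼ ⊚ w₁ ⊚ ⋯ ⊚ wₖ` of `⊚`. -/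
noncomputable def flatten (A : FinBij ⥤ C) {𝔹 : Base} (M : 𝔹.B ⥤ C) : (w' w : Word) →
    Hom (odot (w'.cell A (𝔹 := Base.sigma) A) (w.cell A M)) ((w'.append w).cell A M)
  | .single e, w => collapse (e.eval A (𝔹 := Base.sigma) A) (w.cell A M)
  | .cons e v, w => (assoc (e.eval A (𝔹 := Base.sigma) A) (v.cell A (𝔹 := Base.sigma) A)
      (w.cell A M)).comp (Hom.circ (𝟙 _) (flatten A M v w))

mutual

/-- `EMap X e e' f`: the transformation `f` from the value of `e` to the value of `e'` is a
combination of parenthesization maps and cocomposition maps of `O` and of the comodule `X`. -/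
inductive EMap {O : Cooperad C} : {𝔹 : Base} → (X : Comodule O 𝔹) → (e e' : Expr) →
    (e.eval O.A X.M ⟶ e'.eval O.A X.M) → Prop
  | id {𝔹 : Base} (X : Comodule O 𝔹) (e : Expr) : EMap X e e (𝟙 _)
  | comp {𝔹 : Base} (X : Comodule O 𝔹) {e e' e'' : Expr}
      {f : e.eval O.A X.M ⟶ e'.eval O.A X.M} {g : e'.eval O.A X.M ⟶ e''.eval O.A X.M} :
      EMap X e e' f → EMap X e' e'' g → EMap X e e'' (f ≫ g)
  /-- the cocomposition `Δ_X : X ⟶ O ∘̂ X` -/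
  | cocomp {𝔹 : Base} (X : Comodule O 𝔹) :
      EMap X .atom (.node .atom (.single .atom)) ((circ O.A (base X.M)).lift X.Δ)
  /-- right Kan extension of a transformation on trees -/
  | kan {𝔹 : Base} (X : Comodule O 𝔹) {e e' : Expr} {w w' : Word}
      {h : Hom ((Word.cons e w).cell O.A X.M) ((Word.cons e' w').cell O.A X.M)} :
      WMap X (.cons e w) (.cons e' w') h → EMap X (.node e w) (.node e' w') h.hat

/-- The transformations on trees whose right Kan extensions are the parenthesization and
cocomposition maps, applied to the factors of a composition product. -/
inductive WMap {O : Cooperad C} : {𝔹 : Base} → (X : Comodule O 𝔹) → (w w' : Word) →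
    Hom (w.cell O.A X.M) (w'.cell O.A X.M) → Prop
  | id {𝔹 : Base} (X : Comodule O 𝔹) (w : Word) : WMap X w w (Hom.id _)
  /-- a combination of maps applied to the last factor -/
  | single {𝔹 : Base} (X : Comodule O 𝔹) {e e' : Expr}
      {f : e.eval O.A X.M ⟶ e'.eval O.A X.M} :
      EMap X e e' f → WMap X (.single e) (.single e') (Hom.base f)
  /-- functoriality of `⊚` -/
  | cons {𝔹 : Base} (X : Comodule O 𝔹) {e e' : Expr} {w w' : Word}
      {f : e.eval O.A O.self.M ⟶ e'.eval O.A O.self.M}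
      {h : Hom (w.cell O.A X.M) (w'.cell O.A X.M)} :
      EMap O.self e e' f → WMap X w w' h → WMap X (.cons e w) (.cons e' w') (Hom.circ f h)
  /-- the removal of the parentheses in `(e ∘̂ w'₁ ∘̂ ⋯ ∘̂ w'ⱼ) ⊚ w₁ ⊚ ⋯ ⊚ wₖ` -/
  | paren {𝔹 : Base} (X : Comodule O 𝔹) (e : Expr) (w' w : Word) :
      WMap X (.cons (.node e w') w) (.cons e (w'.append w))
        ((split (circ (e.eval O.A (𝔹 := Base.sigma) O.A)
          (w'.cell O.A (𝔹 := Base.sigma) O.A)).ι (w.cell O.A X.M)).comp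
            (flatten O.A X.M (.cons e w') w))
  /-- the removal of the parentheses of the last factor `(e ∘̂ w₁ ∘̂ ⋯ ∘̂ wₖ)` -/
  | parenLast {𝔹 : Base} (X : Comodule O 𝔹) (e : Expr) (w : Word) :
      WMap X (.single (.node e w)) (.cons e w)
        (Hom.ofTrans (circ (e.eval O.A (𝔹 := Base.sigma) O.A) (w.cell O.A X.M)).ι)
  /-- cocomposition on a factor `O` -/
  | coface {𝔹 : Base} (X : Comodule O 𝔹) (w : Word) :
      WMap X (.cons .atom w) (.cons .atom (.cons .atom w)) (coface O.Δ (w.cell O.A X.M))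
  /-- cocomposition on the last factor -/
  | cofaceLast {𝔹 : Base} (X : Comodule O 𝔹) :
      WMap X (.single .atom) (.cons .atom (.single .atom)) (Hom.ofTrans X.Δ)

end

/-- A coalgebra `(c, Δ_c)` over a cooperad. -/
structure Coalgebra (O : Cooperad C) where
  /-- the object -/
  c : C
  /-- the cocomposition `c γ² ⟶ O ⊚ c` -/
  Δ : (circ O.A (base (𝔹 := Base.zero) ((Functor.const EmptyBij).obj c))).p ⋙
      (Functor.const EmptyBij).obj c ⟶
    (circ O.A (base (𝔹 := Base.zero) ((Functor.const EmptyBij).obj c))).Y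
  coassoc : (coface O.Δ (base (𝔹 := Base.zero) ((Functor.const EmptyBij).obj c))).push Δ =
    (Hom.circ (𝟙 O.A) (Hom.ofTrans Δ)).push Δ
  counit_left b : counitLeft (𝔹 := Base.zero) O.ε Δ b = 𝟙 _

/-- A coalgebra, as a comodule concentrated in arity zero. -/
noncomputable def Coalgebra.toComodule {O : Cooperad C} (c : Coalgebra O) :
    Comodule O Base.zero :=
  ⟨(Functor.const EmptyBij).obj c.c, c.Δ, c.coassoc, c.counit_left⟩

/-- The empty set, as an object of `Σ_0`. -/
def emptySet : EmptyBij := { set := ⟨PEmpty⟩ }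

/-- The object `O^{∘̂ k} ∘̂ c` of `C`. -/
noncomputable def Coalgebra.target {O : Cooperad C} (c : Coalgebra O) (k : ℕ) : C :=
  ((Expr.flat k).eval O.A c.toComodule.M).obj emptySet

end Expressions

end TreeSeq

namespace TreeSeq

section Pull

variable {E : Type u₂} [Category.{0} E] {F : Type u₃} [Category.{0} F] {p : E ⥤ FinBij}

/-- Changing the index set of a decorated set along a bijection. -/
def Wreath.reindex {S : FinBij} (w : Wreath F) (e : S.carrier ≃ w.idx.carrier) :
    (⟨S, fun s => w.lbl (e s)⟩ : Wreath F) ≅ w :=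
  wreathIso e fun _ => Iso.refl _

end Pull

namespace Cell

variable {C : Type u} [Category.{v} C] {𝔹 : Base}

/-- Two morphisms are identified if their functors on trees are isomorphic, compatibly with the
leaves and the transformations. -/
def Hom.Rel {𝒳 𝒴 : Cell 𝔹 C} (h k : Hom 𝒳 𝒴) : Prop :=
  ∃ e : ∀ y, h.q.obj y ≅ k.q.obj y,
    (∀ {y y' : 𝒴.E} (f : y ⟶ y'), h.q.map f ≫ (e y').hom = (e y).hom ≫ k.q.map f) ∧
    (∀ y, 𝒳.p.map (e y).hom ≫ k.θ.hom.app y = h.θ.hom.app y) ∧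
    ∀ y, 𝒳.Y.map (e y).hom ≫ k.τ.app y = h.τ.app y

lemma Hom.Rel.refl {𝒳 𝒴 : Cell 𝔹 C} (h : Hom 𝒳 𝒴) : h.Rel h :=
  ⟨fun _ => Iso.refl _, by simp, by simp, by simp⟩

lemma Hom.Rel.symm {𝒳 𝒴 : Cell 𝔹 C} {h k : Hom 𝒳 𝒴} : h.Rel k → k.Rel h := by
  rintro ⟨e, h₀, h₁, h₂⟩
  refine ⟨fun y => (e y).symm, fun f => ?_, fun y => ?_, fun y => ?_⟩
  · rw [Iso.symm_hom, Iso.symm_hom, Iso.eq_inv_comp, ← reassoc_of% h₀]; simp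
  · rw [← h₁, Iso.symm_hom, ← Functor.map_comp_assoc]; simp
  · rw [← h₂, Iso.symm_hom, ← Functor.map_comp_assoc]; simp

lemma Hom.Rel.trans {𝒳 𝒴 : Cell 𝔹 C} {h k l : Hom 𝒳 𝒴} : h.Rel k → k.Rel l → h.Rel l := by
  rintro ⟨e, h₀, h₁, h₂⟩ ⟨e', h₀', h₁', h₂'⟩
  exact ⟨fun y => e y ≪≫ e' y, fun f => by simp [reassoc_of% h₀, h₀'],
    fun y => by simp [h₁, h₁'], fun y => by simp [h₂, h₂']⟩

/-- Morphisms with the same functor on trees. -/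
lemma Hom.Rel.of_refl {𝒳 𝒴 : Cell 𝔹 C} {q : 𝒴.E ⥤ 𝒳.E} {θ θ' : q ⋙ 𝒳.p ≅ 𝒴.p}
    {τ τ' : q ⋙ 𝒳.Y ⟶ 𝒴.Y} (h₁ : ∀ y, θ'.hom.app y = θ.hom.app y)
    (h₂ : ∀ y, τ'.app y = τ.app y) : (Hom.mk q θ τ).Rel ⟨q, θ', τ'⟩ :=
  ⟨fun _ => Iso.refl _, by simp, by simp [h₁], by simp [h₂]⟩

instance Hom.setoid (𝒳 𝒴 : Cell 𝔹 C) : Setoid (Hom 𝒳 𝒴) :=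
  ⟨Hom.Rel, Hom.Rel.refl, Hom.Rel.symm, Hom.Rel.trans⟩

lemma Hom.comp_θ_app {𝒳 𝒴 𝒵 : Cell 𝔹 C} (h : Hom 𝒳 𝒴) (k : Hom 𝒴 𝒵) (z : 𝒵.E) :
    (h.comp k).θ.hom.app z = h.θ.hom.app (k.q.obj z) ≫ k.θ.hom.app z :=
  Category.id_comp _

lemma Hom.comp_τ_app {𝒳 𝒴 𝒵 : Cell 𝔹 C} (h : Hom 𝒳 𝒴) (k : Hom 𝒴 𝒵) (z : 𝒵.E) :
    (h.comp k).τ.app z = h.τ.app (k.q.obj z) ≫ k.τ.app z :=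
  Category.id_comp _

lemma Hom.Rel.comp {𝒳 𝒴 𝒵 : Cell 𝔹 C} {h h' : Hom 𝒳 𝒴} {k k' : Hom 𝒴 𝒵} :
    h.Rel h' → k.Rel k' → (h.comp k).Rel (h'.comp k') := by
  rintro ⟨e, h₀, h₁, h₂⟩ ⟨d, k₀, k₁, k₂⟩
  refine ⟨fun z => e (k.q.obj z) ≪≫ h'.q.mapIso (d z), fun {z z'} f => ?_, fun z => ?_, fun z => ?_⟩
  · change h.q.map (k.q.map f) ≫ (e _).hom ≫ h'.q.map (d z').hom
      = ((e _).hom ≫ h'.q.map (d z).hom) ≫ h'.q.map (k'.q.map f)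
    rw [reassoc_of% h₀, ← Functor.map_comp, k₀, Functor.map_comp, Category.assoc]
  · have n : 𝒳.p.map (h'.q.map (d z).hom) ≫ h'.θ.hom.app (k'.q.obj z)
      = h'.θ.hom.app (k.q.obj z) ≫ 𝒴.p.map (d z).hom := h'.θ.hom.naturality _
    change 𝒳.p.map ((e (k.q.obj z)).hom ≫ h'.q.map (d z).hom) ≫ _ = _
    rw [Hom.comp_θ_app, Hom.comp_θ_app, ← h₁, ← k₁, Category.assoc, ← reassoc_of% n,
      Functor.map_comp, Category.assoc]
  · have n : 𝒳.Y.map (h'.q.map (d z).hom) ≫ h'.τ.app (k'.q.obj z)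
      = h'.τ.app (k.q.obj z) ≫ 𝒴.Y.map (d z).hom := h'.τ.naturality _
    change 𝒳.Y.map ((e (k.q.obj z)).hom ≫ h'.q.map (d z).hom) ≫ _ = _
    rw [Hom.comp_τ_app, Hom.comp_τ_app, ← h₂, ← k₂, Category.assoc, ← reassoc_of% n,
      Functor.map_comp, Category.assoc]

/-- Cells and morphisms of cells up to isomorphism form a category. -/
instance : Category.{max 1 v} (Cell 𝔹 C) where
  Hom 𝒳 𝒴 := Quotient (Hom.setoid 𝒳 𝒴)
  id 𝒳 := ⟦Hom.id 𝒳⟧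
  comp := Quotient.map₂ Hom.comp fun _ _ h _ _ k => Hom.Rel.comp h k
  id_comp f := by
    induction f using Quotient.ind with | _ h => ?_
    exact Quotient.sound (Hom.Rel.of_refl
      (fun y => ((Hom.comp_θ_app (Hom.id _) h y).trans (Category.id_comp _)).symm)
      (fun y => ((Hom.comp_τ_app (Hom.id _) h y).trans (Category.id_comp _)).symm))
  comp_id f := by
    induction f using Quotient.ind with | _ h => ?_
    exact Quotient.sound (Hom.Rel.of_refl
      (fun y => ((Hom.comp_θ_app h (Hom.id _) y).trans (Category.comp_id _)).symm)
      (fun y => ((Hom.comp_τ_app h (Hom.id _) y).trans (Category.comp_id _)).symm))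
  assoc f g k := by
    induction f using Quotient.ind with | _ f => ?_
    induction g using Quotient.ind with | _ g => ?_
    induction k using Quotient.ind with | _ k => ?_
    refine Quotient.sound (Hom.Rel.of_refl
      (θ := ((f.comp g).comp k).θ) (θ' := (f.comp (g.comp k)).θ)
      (τ := ((f.comp g).comp k).τ) (τ' := (f.comp (g.comp k)).τ) (fun y => ?_) fun y => ?_)
    · refine (Hom.comp_θ_app f (g.comp k) y).trans (Eq.trans ?_
        (Hom.comp_θ_app (f.comp g) k y).symm)
      rw [Hom.comp_θ_app, Hom.comp_θ_app]
      exact (Category.assoc _ _ _).symm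
    · refine (Hom.comp_τ_app f (g.comp k) y).trans (Eq.trans ?_
        (Hom.comp_τ_app (f.comp g) k y).symm)
      rw [Hom.comp_τ_app, Hom.comp_τ_app]
      exact (Category.assoc _ _ _).symm

/-- The class of a morphism of cells up to isomorphism. -/
def Hom.cls {𝒳 𝒴 : Cell 𝔹 C} (h : Hom 𝒳 𝒴) : 𝒳 ⟶ 𝒴 := (⟦h⟧ : Quotient (Hom.setoid 𝒳 𝒴))

lemma cls_id (𝒳 : Cell 𝔹 C) : (Hom.id 𝒳).cls = 𝟙 𝒳 := rfl

lemma cls_surjective {𝒳 𝒴 : Cell 𝔹 C} (f : 𝒳 ⟶ 𝒴) : ∃ h : Hom 𝒳 𝒴, h.cls = f :=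
  Quotient.exists_rep f

lemma Hom.Rel.cls_eq {𝒳 𝒴 : Cell 𝔹 C} {h k : Hom 𝒳 𝒴} (H : h.Rel k) : h.cls = k.cls :=
  Quotient.sound H

/-- The morphism given by a transformation `G p ⟶ 𝒳.Y`. -/
def transMap {G : 𝔹.B ⥤ C} {𝒳 : Cell 𝔹 C} (α : 𝒳.p ⋙ G ⟶ 𝒳.Y) : base G ⟶ 𝒳 :=
  (Hom.ofTrans α).cls

/-- The morphism given by a transformation. -/
def baseMap {M N : 𝔹.B ⥤ C} (f : M ⟶ N) : base M ⟶ base N := (Hom.base f).cls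

lemma baseMap_id (M : 𝔹.B ⥤ C) : baseMap (𝟙 M) = 𝟙 (base M) :=
  Hom.Rel.cls_eq (Hom.Rel.of_refl (fun _ => rfl) fun _ => (Category.comp_id _).symm)

lemma transMap_comp_cls {G : 𝔹.B ⥤ C} {𝒳 𝒴 : Cell 𝔹 C} (α : 𝒳.p ⋙ G ⟶ 𝒳.Y) (h : Hom 𝒳 𝒴) :
    transMap α ≫ h.cls = transMap (h.push α) := by
  refine Hom.Rel.cls_eq (h := (Hom.ofTrans α).comp h) ⟨h.θ.app, fun f => h.θ.hom.naturality f,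
    fun y => ?_, fun y => ?_⟩
  · rw [Hom.comp_θ_app]
    exact (Category.comp_id _).trans (Category.id_comp _).symm
  · rw [Hom.comp_τ_app]
    have e : (h.push α).app y = G.map (h.θ.inv.app y) ≫ α.app (h.q.obj y) ≫ h.τ.app y :=
      congrArg (G.map (h.θ.inv.app y) ≫ ·) (Category.id_comp _)
    refine (congrArg (_ ≫ ·) e).trans ((Category.assoc _ _ _).symm.trans ?_)
    refine (congrArg (· ≫ _) ?_).trans (Category.id_comp _)
    exact (G.map_comp _ _).symm.trans ((congrArg G.map (h.θ.hom_inv_id_app y)).trans (G.map_id _))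

lemma baseMap_comp_transMap {G M : 𝔹.B ⥤ C} (f : G ⟶ M) {𝒳 : Cell 𝔹 C} (α : 𝒳.p ⋙ M ⟶ 𝒳.Y) :
    baseMap f ≫ transMap α = transMap (Functor.whiskerLeft 𝒳.p f ≫ α) := by
  refine Hom.Rel.cls_eq (h := (Hom.base f).comp (Hom.ofTrans α)) (Hom.Rel.of_refl
    (fun y => ?_) fun y => ?_)
  · exact ((Hom.comp_θ_app (Hom.base f) (Hom.ofTrans α) y).trans (Category.id_comp _)).symm
  · refine Eq.symm ((Hom.comp_τ_app (Hom.base f) (Hom.ofTrans α) y).trans ?_)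
    exact congrArg (· ≫ _) (Category.id_comp _)

lemma baseMap_comp {G M N : 𝔹.B ⥤ C} (f : G ⟶ M) (g : M ⟶ N) :
    baseMap (f ≫ g) = baseMap f ≫ baseMap g := by
  refine (Hom.Rel.cls_eq (h := (Hom.base f).comp (Hom.base g)) (Hom.Rel.of_refl
    (fun y => ?_) fun y => ?_)).symm
  · exact ((Hom.comp_θ_app (Hom.base f) (Hom.base g) y).trans (Category.id_comp _)).symm
  · refine Eq.symm ((Hom.comp_τ_app (Hom.base f) (Hom.base g) y).trans ?_)
    exact congrArg₂ (· ≫ ·) (Category.id_comp _) (Category.id_comp _) |>.trans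
      (Category.id_comp _).symm

lemma transMap_injective {G : 𝔹.B ⥤ C} {𝒳 : Cell 𝔹 C} {α β : 𝒳.p ⋙ G ⟶ 𝒳.Y}
    (h : transMap α = transMap β) : α = β := by
  obtain ⟨e, _, h₁, h₂⟩ : (Hom.ofTrans α).Rel (Hom.ofTrans β) := Quotient.exact h
  ext x
  have h₃ : (e x).hom = 𝟙 _ := (Category.comp_id _).symm.trans (h₁ x)
  refine (h₂ x).symm.trans ((congrArg (· ≫ _) ?_).trans (Category.id_comp _))
  exact (congrArg G.map h₃).trans (G.map_id _)

section Kan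

variable [HasLimitsOfSize.{0, 0} C]

lemma whiskerLeft_lift {𝒳 : Cell 𝔹 C} {G : 𝔹.B ⥤ C} (α : 𝒳.p ⋙ G ⟶ 𝒳.Y) :
    Functor.whiskerLeft 𝒳.p (𝒳.lift α) ≫ 𝒳.ι = α :=
  Functor.liftOfIsRightKanExtension_fac (𝒳.p.rightKanExtension 𝒳.Y)
    (𝒳.p.rightKanExtensionCounit 𝒳.Y) G α

lemma baseMap_lift_comp_ι {𝒳 : Cell 𝔹 C} {G : 𝔹.B ⥤ C} (α : 𝒳.p ⋙ G ⟶ 𝒳.Y) :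
    baseMap (𝒳.lift α) ≫ transMap 𝒳.ι = transMap α := by
  rw [baseMap_comp_transMap, whiskerLeft_lift]

lemma baseMap_hat_comp_ι {𝒳 𝒴 : Cell 𝔹 C} (h : Hom 𝒳 𝒴) :
    baseMap h.hat ≫ transMap 𝒴.ι = transMap 𝒳.ι ≫ h.cls := by
  rw [Hom.hat, baseMap_lift_comp_ι, transMap_comp_cls]

lemma hat_hom_ext {𝒳 : Cell 𝔹 C} {G : 𝔹.B ⥤ C} {f g : G ⟶ 𝒳.hat}
    (h : baseMap f ≫ transMap 𝒳.ι = baseMap g ≫ transMap 𝒳.ι) :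
    f = g := by
  rw [baseMap_comp_transMap, baseMap_comp_transMap] at h
  exact Functor.hom_ext_of_isRightKanExtension (𝒳.p.rightKanExtension 𝒳.Y)
    (𝒳.p.rightKanExtensionCounit 𝒳.Y) f g (transMap_injective h)

end Kan

end Cell

/-- The bijection underlying a morphism of `Σ_*`. -/
def FinBij.equiv {S T : FinBij} (f : S ⟶ T) : S.carrier ≃ T.carrier := f

section WreathMaps

variable {A : Type u₁} [Category.{v₁} A] {B : Type u₂} [Category.{v₂} B]

lemma Wreath.σ_comp_inv {x y z : Wreath A} (a : x ⟶ z) (b : y ≅ z)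
    (P : (Wreath.forget A).obj x ⟶ (Wreath.forget A).obj y)
    (h : (Wreath.forget A).map a = P ≫ (Wreath.forget A).map b.hom) :
    (a ≫ b.inv).σ = P := by
  refine ((Wreath.forget A).map_comp a b.inv).trans ?_
  rw [h, Category.assoc, ← Functor.map_comp, b.hom_inv_id, CategoryTheory.Functor.map_id]
  exact Category.comp_id P

lemma map_square_comp (F : A ⥤ B) {a b c d : A} {z w : B} {l : a ⟶ b} {i : b ⟶ c} {i' : a ⟶ d}
    {j : d ⟶ c} {m : F.obj c ⟶ z} {m' : F.obj d ⟶ w} {r : w ⟶ z} (e : l ≫ i = i' ≫ j)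
    (n : F.map j ≫ m = m' ≫ r) : F.map l ≫ F.map i ≫ m = (F.map i' ≫ m') ≫ r := by
  rw [← Functor.map_comp_assoc, e, Functor.map_comp_assoc, n, Category.assoc]

end WreathMaps

namespace Cell

variable {C : Type u} [Category.{v} C] {𝔹 : Base}

section Leaves

variable {𝒳 𝒳' : Cell Base.sigma C} {𝒴 𝒴' : Cell 𝔹 C} (h : Hom 𝒳 𝒳') (k : Hom 𝒴 𝒴')

/-- Pulling back a decorated tree along two morphisms of cells. -/
abbrev pullObj (x : Pull 𝒳'.p 𝒴'.E) : Pull 𝒳.p 𝒴.E :=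
  ⟨h.q.obj x.tree, fun s => k.q.obj (x.lbl (FinBij.equiv (h.θ.hom.app x.tree) s))⟩

/-- The decorated leaves of the pulled back tree. -/
def leafIso (x : Pull 𝒳'.p 𝒴'.E) : (pullObj h k x).wreath ≅ (Wreath.map k.q).obj x.wreath :=
  Wreath.reindex (S := (h.q ⋙ 𝒳.p).obj x.tree) ((Wreath.map k.q).obj x.wreath)
    (FinBij.equiv (h.θ.hom.app x.tree))

lemma pull_comm {x y : Pull 𝒳'.p 𝒴'.E} (f : x ⟶ y) :
    (((leafIso h k x).hom ≫ (Wreath.map k.q).map f.leaf) ≫ (leafIso h k y).inv).σ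
      = 𝒳.p.map (h.q.map f.tree) :=
  Wreath.σ_comp_inv ((leafIso h k x).hom ≫ (Wreath.map k.q).map f.leaf) (leafIso h k y)
    (𝒳.p.map (h.q.map f.tree))
    ((congrArg (h.θ.hom.app x.tree ≫ ·) f.comm).trans (h.θ.hom.naturality f.tree).symm)

/-- The functor underlying the product of two morphisms of cells. -/
abbrev pullFunctor : Pull 𝒳'.p 𝒴'.E ⥤ Pull 𝒳.p 𝒴.E where
  obj := pullObj h k
  map {x y} f := ⟨h.q.map f.tree,
    ((leafIso h k x).hom ≫ (Wreath.map k.q).map f.leaf) ≫ (leafIso h k y).inv,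
      pull_comm h k f⟩
  map_id x := Pull.Hom.ext (h.q.map_id _) (by
    refine (congrArg (fun g => ((leafIso h k x).hom ≫ g) ≫ (leafIso h k x).inv)
      ((Wreath.map k.q).map_id x.wreath)).trans ?_
    rw [Category.comp_id]
    exact (leafIso h k x).hom_inv_id)
  map_comp {x y z} f g := Pull.Hom.ext (h.q.map_comp _ _) (by
    refine (congrArg (fun j => ((leafIso h k x).hom ≫ j) ≫ (leafIso h k z).inv)
      ((Wreath.map k.q).map_comp f.leaf g.leaf)).trans ?_
    change _ = (((leafIso h k x).hom ≫ (Wreath.map k.q).map f.leaf) ≫ (leafIso h k y).inv) ≫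
      ((leafIso h k y).hom ≫ (Wreath.map k.q).map g.leaf) ≫ (leafIso h k z).inv
    simp only [Category.assoc, Iso.inv_hom_id_assoc])

lemma pullFunctor_map_leaf {x y : Pull 𝒳'.p 𝒴'.E} (f : x ⟶ y) :
    ((pullFunctor h k).map f).leaf ≫ (leafIso h k y).hom
      = (leafIso h k x).hom ≫ (Wreath.map k.q).map f.leaf :=
  ((Category.assoc _ _ _).trans (congrArg (_ ≫ ·) (Iso.inv_hom_id _))).trans (Category.comp_id _)

/-- The transformation of decorated leaves induced by a transformation of decorations. -/
def leafMap {D : Type u₁} [Category.{v₁} D] {Z : 𝒴.E ⥤ D} {Z' : 𝒴'.E ⥤ D} (β : k.q ⋙ Z ⟶ Z') :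
    pullFunctor h k ⋙ Pull.snd 𝒳.p 𝒴.E ⋙ Wreath.map Z ⟶ Pull.snd 𝒳'.p 𝒴'.E ⋙ Wreath.map Z' where
  app x := (Wreath.map Z).map (leafIso h k x).hom ≫ (Wreath.mapNat β).app x.wreath
  naturality x y f := by
    have n : (Wreath.map Z).map ((Wreath.map k.q).map f.leaf) ≫ (Wreath.mapNat β).app y.wreath
      = (Wreath.mapNat β).app x.wreath ≫ (Wreath.map Z').map f.leaf :=
      (Wreath.mapNat β).naturality f.leaf
    exact map_square_comp (Wreath.map Z) (pullFunctor_map_leaf h k f) n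

/-- The same for isomorphisms. -/
def leafMapIso {D : Type u₁} [Category.{v₁} D] {Z : 𝒴.E ⥤ D} {Z' : 𝒴'.E ⥤ D} (β : k.q ⋙ Z ≅ Z') :
    pullFunctor h k ⋙ Pull.snd 𝒳.p 𝒴.E ⋙ Wreath.map Z ≅ Pull.snd 𝒳'.p 𝒴'.E ⋙ Wreath.map Z' :=
  NatIso.ofComponents
    (fun x => (Wreath.map Z).mapIso (leafIso h k x) ≪≫ (Wreath.mapNatIso β).app x.wreath)
    fun f => (leafMap h k β.hom).naturality f

end Leaves

variable [MonoidalCategory C] [SymmetricCategory C]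

/-- Functoriality of `⊚`. -/
noncomputable def Hom.odot {𝒳 𝒳' : Cell Base.sigma C} {𝒴 𝒴' : Cell 𝔹 C} (h : Hom 𝒳 𝒳')
    (k : Hom 𝒴 𝒴') : Hom (Cell.odot 𝒳 𝒴) (Cell.odot 𝒳' 𝒴') where
  q := pullFunctor h k
  θ := Functor.isoWhiskerRight (leafMapIso h k k.θ) 𝔹.act
  τ := { app := fun x => h.τ.app x.tree ⊗ₘ (bigTensor C).map ((leafMap h k k.τ).app x)
         naturality := fun x y f => by
          have n₁ : 𝒳.Y.map (h.q.map f.tree) ≫ h.τ.app y.tree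
            = h.τ.app x.tree ≫ 𝒳'.Y.map f.tree := h.τ.naturality f.tree
          have n₂ : (Wreath.map 𝒴.Y).map ((pullFunctor h k).map f).leaf ≫ (leafMap h k k.τ).app y
            = (leafMap h k k.τ).app x ≫ (Wreath.map 𝒴'.Y).map f.leaf :=
              (leafMap h k k.τ).naturality f
          refine (tensorHom_comp_tensorHom _ _ _ _).trans
            (Eq.trans ?_ (tensorHom_comp_tensorHom _ _ _ _).symm)
          refine congrArg₂ (· ⊗ₘ ·) n₁ (Eq.trans ?_ ((congrArg (bigTensor C).map n₂).trans ?_))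
          · exact ((bigTensor C).map_comp _ _).symm
          · exact (bigTensor C).map_comp _ _ }

/-- A criterion for the identification of two morphisms out of a product. -/
lemma Hom.Rel.of_odot {𝒳 : Cell Base.sigma C} {𝒴 𝒵 : Cell 𝔹 C} {h k : Hom (Cell.odot 𝒳 𝒴) 𝒵}
    (t : ∀ z, (h.q.obj z).tree ≅ (k.q.obj z).tree)
    (w : ∀ z, (h.q.obj z).wreath ≅ (k.q.obj z).wreath)
    (hσ : ∀ z, (w z).hom.σ = 𝒳.p.map (t z).hom)
    (ht : ∀ {z z'} (f : z ⟶ z'), (h.q.map f).tree ≫ (t z').hom = (t z).hom ≫ (k.q.map f).tree)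
    (hw : ∀ {z z'} (f : z ⟶ z'), (h.q.map f).leaf ≫ (w z').hom = (w z).hom ≫ (k.q.map f).leaf)
    (hθ : ∀ z, 𝔹.act.map ((Wreath.map 𝒴.p).map (w z).hom) ≫ k.θ.hom.app z = h.θ.hom.app z)
    (hτ : ∀ z, (𝒳.Y.map (t z).hom ⊗ₘ (bigTensor C).map ((Wreath.map 𝒴.Y).map (w z).hom)) ≫
      k.τ.app z = h.τ.app z) : h.Rel k :=
  ⟨fun z => pullIso (t z) (w z) (hσ z), fun f => Pull.Hom.ext (ht f) (hw f), hθ, hτ⟩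

end Cell

section WreathMaps

variable {A : Type u₁} [Category.{v₁} A] {B : Type u₂} [Category.{v₂} B]

lemma natural_of_isos {a b c d a' b' : A} {l : a ⟶ b} {l' : a' ⟶ b'} {j : c ⟶ d} {i : a ⟶ c}
    {i' : b ⟶ d} {k : a' ≅ c} {k' : b' ≅ d} (e : l ≫ i' = i ≫ j)
    (e' : l' ≫ k'.hom = k.hom ≫ j) : l ≫ i' ≫ k'.inv = (i ≫ k.inv) ≫ l' := by
  rw [← cancel_mono k'.hom]
  simp [e, e']

lemma map_comp_inv_comp (F : A ⥤ B) {a b c : A} (i : a ⟶ c) (k : b ≅ c) {z : B} (m : F.obj c ⟶ z) :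
    F.map (i ≫ k.inv) ≫ F.map k.hom ≫ m = F.map i ≫ m := by
  rw [← Functor.map_comp_assoc, Category.assoc, k.inv_hom_id, Category.comp_id]

lemma map_comp_comp_comp (F : A ⥤ B) {a b c : A} {z z' w : B} {i : a ⟶ b} {j : b ⟶ c}
    {m : F.obj b ⟶ z} {r : z ⟶ z'} {n : F.obj c ⟶ z'} {m' : z' ⟶ w} {m'' : F.obj c ⟶ w}
    (h : m ≫ r = F.map j ≫ n) (h' : n ≫ m' = m'') :
    (F.map i ≫ m) ≫ r ≫ m' = F.map (i ≫ j) ≫ m'' := by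
  rw [Category.assoc, reassoc_of% h, h', Functor.map_comp_assoc]

lemma tensor_map_comp_comp [MonoidalCategory B] (F : A ⥤ B) {a b c d : A} {x y z w : B}
    {f : x ⟶ y} {g : y ⟶ z} {h : z ⟶ w} {k : x ⟶ w} {f' : a ⟶ b} {g' : b ⟶ c} {h' : c ⟶ d}
    {k' : a ⟶ d} (e : f ≫ g ≫ h = k) (e' : f' ≫ g' ≫ h' = k') :
    (f ⊗ₘ F.map f') ≫ (g ⊗ₘ F.map g') ≫ (h ⊗ₘ F.map h') = k ⊗ₘ F.map k' := by
  rw [tensorHom_comp_tensorHom, tensorHom_comp_tensorHom, e, ← F.map_comp, ← F.map_comp, e']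

end WreathMaps

namespace Cell

variable {C : Type u} [Category.{v} C] {𝔹 : Base}

section Congruence

variable {𝒳 𝒳' : Cell Base.sigma C} {𝒴 𝒴' : Cell 𝔹 C} {h h' : Hom 𝒳 𝒳'} {k k' : Hom 𝒴 𝒴'}

/-- Comparison of the decorated leaves of two pulled back trees. -/
def leafCompare (d : k.q ≅ k'.q) (x : Pull 𝒳'.p 𝒴'.E) :
    (pullObj h k x).wreath ≅ (pullObj h' k' x).wreath :=
  (leafIso h k x ≪≫ (Wreath.mapNatIso d).app x.wreath) ≪≫ (leafIso h' k' x).symm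

lemma leafCompare_comp (d : k.q ≅ k'.q) (x : Pull 𝒳'.p 𝒴'.E)
    {D : Type u₁} [Category.{v₁} D] {Z : 𝒴.E ⥤ D} {Z' : 𝒴'.E ⥤ D} (β : k.q ⋙ Z ⟶ Z')
    (β' : k'.q ⋙ Z ⟶ Z') (hd : ∀ y, Z.map (d.hom.app y) ≫ β'.app y = β.app y) :
    (Wreath.map Z).map (leafCompare (h := h) (h' := h') d x).hom ≫ (leafMap h' k' β').app x
      = (leafMap h k β).app x := by
  have e : (Wreath.map Z).map ((Wreath.mapNat d.hom).app x.wreath) ≫ (Wreath.mapNat β').app x.wreath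
      = (Wreath.mapNat β).app x.wreath :=
    Wreath.Hom.ext' (fun _ => rfl) fun s => (Category.comp_id _).trans (hd _)
  refine (map_comp_inv_comp (Wreath.map Z) _ (leafIso h' k' x) _).trans ?_
  refine (congrArg (· ≫ _) ((Wreath.map Z).map_comp _ _)).trans ((Category.assoc _ _ _).trans ?_)
  exact congrArg (_ ≫ ·) e

end Congruence

variable [MonoidalCategory C] [SymmetricCategory C]

lemma Hom.Rel.odot {𝒳 𝒳' : Cell Base.sigma C} {𝒴 𝒴' : Cell 𝔹 C} {h h' : Hom 𝒳 𝒳'}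
    {k k' : Hom 𝒴 𝒴'} : h.Rel h' → k.Rel k' → (h.odot k).Rel (h'.odot k') := by
  rintro ⟨e, h₀, h₁, h₂⟩ ⟨d, k₀, k₁, k₂⟩
  let δ : k.q ≅ k'.q := NatIso.ofComponents d k₀
  refine Hom.Rel.of_odot (fun x => e x.tree) (fun x => leafCompare δ x) (fun x => ?_)
    (fun f => h₀ f.tree) (fun {x y} f => ?_) (fun x => ?_) (fun x => ?_)
  · exact Wreath.σ_comp_inv ((leafIso h k x).hom ≫ (Wreath.mapNat δ.hom).app x.wreath)
      (leafIso h' k' x) (𝒳.p.map (e x.tree).hom)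
      ((Category.comp_id (h.θ.hom.app x.tree)).trans (h₁ x.tree).symm)
  · refine natural_of_isos (j := (Wreath.map k'.q).map f.leaf) ?_ (pullFunctor_map_leaf h' k' f)
    refine (Category.assoc _ _ _).symm.trans
      ((congrArg (· ≫ _) (pullFunctor_map_leaf h k f)).trans ?_)
    refine (Category.assoc _ _ _).trans (Eq.trans ?_ (Category.assoc _ _ _).symm)
    exact congrArg (_ ≫ ·) ((Wreath.mapNat δ.hom).naturality f.leaf)
  · refine (𝔹.act.map_comp _ _).symm.trans (congrArg 𝔹.act.map ?_)
    exact leafCompare_comp δ x k.θ.hom k'.θ.hom k₁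
  · refine (tensorHom_comp_tensorHom _ _ _ _).trans (congrArg₂ (· ⊗ₘ ·) (h₂ x.tree) ?_)
    refine ((bigTensor C).map_comp _ _).symm.trans (congrArg (bigTensor C).map ?_)
    exact leafCompare_comp δ x k.τ k'.τ k₂

/-- The product of two morphisms of cells. -/
noncomputable def odotMap {𝒳 𝒳' : Cell Base.sigma C} {𝒴 𝒴' : Cell 𝔹 C} :
    (𝒳 ⟶ 𝒳') → (𝒴 ⟶ 𝒴') → (odot 𝒳 𝒴 ⟶ odot 𝒳' 𝒴') :=
  Quotient.map₂ Hom.odot fun _ _ h _ _ k => Hom.Rel.odot h k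

lemma odotMap_id (𝒳 : Cell Base.sigma C) (𝒴 : Cell 𝔹 C) : odotMap (𝟙 𝒳) (𝟙 𝒴) = 𝟙 _ := by
  refine Hom.Rel.cls_eq (h := (Hom.id 𝒳).odot (Hom.id 𝒴)) (k := Hom.id _)
    (Hom.Rel.of_odot (fun x => Iso.refl _) (fun x => leafIso (Hom.id 𝒳) (Hom.id 𝒴) x)
    (fun x => (𝒳.p.map_id _).symm)
    (fun f => (Category.comp_id _).trans (Category.id_comp _).symm)
    (fun f => pullFunctor_map_leaf (Hom.id 𝒳) (Hom.id 𝒴) f) (fun x => ?_) fun x => ?_)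
  · refine (Category.comp_id _).trans (congrArg 𝔹.act.map ?_)
    exact (Category.comp_id _).symm
  · refine (Category.comp_id _).trans (congrArg₂ (· ⊗ₘ ·) (𝒳.Y.map_id _)
      (congrArg (bigTensor C).map ?_))
    exact (Category.comp_id _).symm

section Composition

variable {𝒳 𝒳' 𝒳'' : Cell Base.sigma C} {𝒴 𝒴' 𝒴'' : Cell 𝔹 C} (h : Hom 𝒳 𝒳') (h' : Hom 𝒳' 𝒳'')
  (k : Hom 𝒴 𝒴') (k' : Hom 𝒴' 𝒴'')

/-- The decorated leaves of a tree pulled back twice. -/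
def leafIsoTwo (x : Pull 𝒳''.p 𝒴''.E) :
    (pullObj h k (pullObj h' k' x)).wreath ≅ (Wreath.map (k'.q ⋙ k.q)).obj x.wreath :=
  leafIso h k (pullObj h' k' x) ≪≫ (Wreath.map k.q).mapIso (leafIso h' k' x)

lemma leafIsoTwo_comp (x : Pull 𝒳''.p 𝒴''.E) {D : Type u₁} [Category.{v₁} D] {Z : 𝒴.E ⥤ D}
    {Z' : 𝒴'.E ⥤ D} {Z'' : 𝒴''.E ⥤ D} (β : k.q ⋙ Z ⟶ Z') (β' : k'.q ⋙ Z' ⟶ Z'')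
    (β'' : (k'.q ⋙ k.q) ⋙ Z ⟶ Z'') (hβ : ∀ y, β''.app y = β.app (k'.q.obj y) ≫ β'.app y) :
    (Wreath.map Z).map ((leafIso (h.comp h') (k.comp k') x).hom ≫ (leafIsoTwo h h' k k' x).inv) ≫
      (leafMap h k β).app (pullObj h' k' x) ≫ (leafMap h' k' β').app x
      = (leafMap (h.comp h') (k.comp k') β'').app x := by
  have e : (Wreath.mapNat β).app ((Wreath.map k'.q).obj x.wreath) ≫ (Wreath.mapNat β').app x.wreath
      = (Wreath.mapNat β'').app x.wreath :=
    Wreath.Hom.ext' (fun _ => rfl) fun s => (Category.comp_id _).trans (hβ _).symm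
  have e' : (leafMap h k β).app (pullObj h' k' x) ≫ (leafMap h' k' β').app x
      = (Wreath.map Z).map (leafIsoTwo h h' k k' x).hom ≫ (Wreath.mapNat β'').app x.wreath := by
    have n : (Wreath.mapNat β).app (pullObj h' k' x).wreath ≫
        (Wreath.map Z').map (leafIso h' k' x).hom =
      (Wreath.map Z).map ((Wreath.map k.q).map (leafIso h' k' x).hom) ≫
        (Wreath.mapNat β).app ((Wreath.map k'.q).obj x.wreath) :=
      ((Wreath.mapNat β).naturality _).symm
    exact map_comp_comp_comp (Wreath.map Z) n e
  exact (congrArg (_ ≫ ·) e').trans (map_comp_inv_comp (Wreath.map Z) _ (leafIsoTwo h h' k k' x) _)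

lemma Hom.odot_comp_rel : ((h.comp h').odot (k.comp k')).Rel ((h.odot k).comp (h'.odot k')) := by
  refine Hom.Rel.of_odot (fun x => Iso.refl _)
    (fun x => leafIso (h.comp h') (k.comp k') x ≪≫ (leafIsoTwo h h' k k' x).symm) (fun x => ?_)
    (fun f => (Category.comp_id _).trans (Category.id_comp _).symm)
    (fun {x y} f => ?_) (fun x => ?_) (fun x => ?_)
  · refine Eq.trans ?_ (𝒳.p.map_id _).symm
    refine Wreath.σ_comp_inv (leafIso (h.comp h') (k.comp k') x).hom (leafIsoTwo h h' k k' x) (𝟙 _) ?_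
    exact (Hom.comp_θ_app h h' x.tree).trans (Category.id_comp _).symm
  · refine natural_of_isos (j := (Wreath.map (k'.q ⋙ k.q)).map f.leaf)
      (pullFunctor_map_leaf (h.comp h') (k.comp k') f) ?_
    refine (Category.assoc _ _ _).symm.trans ((congrArg (· ≫ _)
      (pullFunctor_map_leaf h k ((pullFunctor h' k').map f))).trans ?_)
    refine (Category.assoc _ _ _).trans (Eq.trans ?_ (Category.assoc _ _ _).symm)
    refine congrArg (_ ≫ ·) (((Wreath.map k.q).map_comp _ _).symm.trans
      ((congrArg (Wreath.map k.q).map (pullFunctor_map_leaf h' k' f)).trans ?_))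
    exact (Wreath.map k.q).map_comp _ _
  · refine (congrArg (_ ≫ ·) (Hom.comp_θ_app (h.odot k) (h'.odot k') x)).trans ?_
    refine (congrArg (_ ≫ ·) (𝔹.act.map_comp _ _).symm).trans ?_
    refine (𝔹.act.map_comp _ _).symm.trans (congrArg 𝔹.act.map ?_)
    exact leafIsoTwo_comp h h' k k' x k.θ.hom k'.θ.hom (k.comp k').θ.hom (Hom.comp_θ_app k k')
  · refine (congrArg (_ ≫ ·) (Hom.comp_τ_app (h.odot k) (h'.odot k') x)).trans ?_
    refine tensor_map_comp_comp (bigTensor C) ?_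
      (leafIsoTwo_comp h h' k k' x k.τ k'.τ (k.comp k').τ (Hom.comp_τ_app k k'))
    refine (congrArg (· ≫ _) (𝒳.Y.map_id _)).trans ((Category.id_comp _).trans ?_)
    exact (Hom.comp_τ_app h h' x.tree).symm

end Composition

lemma odotMap_comp {𝒳 𝒳' 𝒳'' : Cell Base.sigma C} {𝒴 𝒴' 𝒴'' : Cell 𝔹 C} (f : 𝒳 ⟶ 𝒳')
    (f' : 𝒳' ⟶ 𝒳'') (g : 𝒴 ⟶ 𝒴') (g' : 𝒴' ⟶ 𝒴'') :
    odotMap (f ≫ f') (g ≫ g') = odotMap f g ≫ odotMap f' g' := by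
  obtain ⟨f, rfl⟩ := cls_surjective f
  obtain ⟨f', rfl⟩ := cls_surjective f'
  obtain ⟨g, rfl⟩ := cls_surjective g
  obtain ⟨g', rfl⟩ := cls_surjective g'
  exact (Hom.odot_comp_rel f f' g g').cls_eq

end Cell

namespace Cell

variable {C : Type u} [Category.{v} C] {𝔹 : Base} [MonoidalCategory C] [SymmetricCategory C]

lemma split_τ_app {R : FinBij ⥤ C} {𝒳 : Cell Base.sigma C} (ρ : 𝒳.p ⋙ R ⟶ 𝒳.Y) (𝒴 : Cell 𝔹 C)
    (x : Pull 𝒳.p 𝒴.E) : (split ρ 𝒴).τ.app x = ρ.app x.tree ⊗ₘ 𝟙 _ :=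
  congrArg (· ⊗ₘ 𝟙 _) ((congrArg (· ≫ _) (R.map_id _)).trans (Category.id_comp _))

/-- The product with a functor on trees of level one. -/
noncomputable def collapseIso (A : FinBij ⥤ C) (𝒴 : Cell 𝔹 C) :
    odot (base (𝔹 := Base.sigma) A) 𝒴 ≅ circ A 𝒴 where
  hom := (collapse A 𝒴).cls
  inv := (split (𝒳 := base (𝔹 := Base.sigma) A) (𝟙 A) 𝒴).cls
  hom_inv_id := by
    refine Hom.Rel.cls_eq (h := (collapse A 𝒴).comp
      (split (𝒳 := base (𝔹 := Base.sigma) A) (𝟙 A) 𝒴)) (k := Hom.id _)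
      (Hom.Rel.of_odot (fun x => Iso.refl _) (fun x => Iso.refl _) (fun x => rfl)
        (fun f => ?_) (fun f => (Category.comp_id _).trans (Category.id_comp _).symm)
        (fun x => ?_) fun x => ?_)
    · exact (Category.comp_id _).trans (f.comm.trans (Category.id_comp _).symm)
    · refine Eq.trans ?_ (Hom.comp_θ_app (collapse A 𝒴)
        (split (𝒳 := base (𝔹 := Base.sigma) A) (𝟙 A) 𝒴) x).symm
      exact congrArg (· ≫ 𝟙 _) ((Wreath.map 𝒴.p ⋙ 𝔹.act).map_id x.wreath)
    · refine Eq.trans ?_ ((Hom.comp_τ_app (collapse A 𝒴)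
        (split (𝒳 := base (𝔹 := Base.sigma) A) (𝟙 A) 𝒴) x).trans
        (congrArg (_ ≫ ·) (split_τ_app _ 𝒴 x))).symm
      refine (Category.comp_id _).trans (Eq.trans ?_ (Category.id_comp _).symm)
      exact congrArg₂ (· ⊗ₘ ·) (A.map_id _) ((Wreath.map 𝒴.Y ⋙ bigTensor C).map_id x.wreath)
  inv_hom_id := by
    refine Hom.Rel.cls_eq (h := (split (𝒳 := base (𝔹 := Base.sigma) A) (𝟙 A) 𝒴).comp
      (collapse A 𝒴)) (k := Hom.id _) ⟨fun _ => Iso.refl _, fun f => ?_, fun x => ?_, fun x => ?_⟩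
    · exact (Category.comp_id _).trans (Category.id_comp _).symm
    · refine Eq.trans ?_ (Hom.comp_θ_app (split (𝒳 := base (𝔹 := Base.sigma) A) (𝟙 A) 𝒴)
        (collapse A 𝒴) x).symm
      exact congrArg (· ≫ 𝟙 _) ((Wreath.map 𝒴.p ⋙ 𝔹.act).map_id x)
    · refine Eq.trans ?_ ((Hom.comp_τ_app (split (𝒳 := base (𝔹 := Base.sigma) A) (𝟙 A) 𝒴)
        (collapse A 𝒴) x).trans
        (congrArg (· ≫ 𝟙 _) (split_τ_app (𝒳 := base (𝔹 := Base.sigma) A) (𝟙 A) 𝒴 _))).symm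
      refine congrArg (· ≫ 𝟙 _) ?_
      exact congrArg₂ (· ⊗ₘ ·) (A.map_id _) ((Wreath.map 𝒴.Y ⋙ bigTensor C).map_id x)

lemma odotMap_comp_collapse {A A' : FinBij ⥤ C} (f : A ⟶ A') {𝒴 𝒴' : Cell 𝔹 C} (h : Hom 𝒴 𝒴') :
    odotMap (baseMap (𝔹 := Base.sigma) f) h.cls ≫ (collapseIso A' 𝒴').hom
      = (collapseIso A 𝒴).hom ≫ (Hom.circ f h).cls := by
  refine Hom.Rel.cls_eq (h := ((Hom.base (𝔹 := Base.sigma) f).odot h).comp (collapse A' 𝒴'))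
    (k := (collapse A 𝒴).comp (Hom.circ f h))
    (Hom.Rel.of_odot (fun x => Iso.refl _)
      (fun x => leafIso (Hom.base (𝔹 := Base.sigma) f) h ⟨x.idx, x.lbl⟩) (fun x => rfl)
        (fun f => ?_) (fun g => ?_)
        (fun x => ?_) fun x => ?_)
  · exact (Category.comp_id _).trans (Category.id_comp _).symm
  · exact pullFunctor_map_leaf (Hom.base (𝔹 := Base.sigma) f) h
      ((collapse A' 𝒴').q.map g)
  · refine (congrArg (_ ≫ ·) ((Hom.comp_θ_app (collapse A 𝒴) (Hom.circ f h) x).trans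
      (Category.id_comp _))).trans (Eq.trans ?_
      (Hom.comp_θ_app ((Hom.base (𝔹 := Base.sigma) f).odot h) (collapse A' 𝒴') x).symm)
    refine Eq.trans ?_ (Category.comp_id _).symm
    exact (𝔹.act.map_comp _ _).symm
  · refine (congrArg (_ ≫ ·) ((Hom.comp_τ_app (collapse A 𝒴) (Hom.circ f h) x).trans
      (Category.id_comp _))).trans (Eq.trans ?_
      (Hom.comp_τ_app ((Hom.base (𝔹 := Base.sigma) f).odot h) (collapse A' 𝒴') x).symm)
    refine Eq.trans ?_ (Category.comp_id _).symm
    refine (tensorHom_comp_tensorHom _ _ _ _).trans (congrArg₂ (· ⊗ₘ ·) ?_ ?_)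
    · exact congrArg (· ≫ _) (A.map_id _)
    · exact ((bigTensor C).map_comp _ _).symm

lemma collapse_comp_split {R : FinBij ⥤ C} {𝒳 : Cell Base.sigma C} (ρ : 𝒳.p ⋙ R ⟶ 𝒳.Y)
    (𝒴 : Cell 𝔹 C) :
    (collapseIso R 𝒴).hom ≫ (split ρ 𝒴).cls = odotMap (transMap ρ) (𝟙 𝒴) := by
  refine Hom.Rel.cls_eq (k := (collapse R 𝒴).comp (split ρ 𝒴))
    (h := ((Hom.ofTrans ρ).odot (Hom.id 𝒴)))
    (Hom.Rel.of_odot (fun x => Iso.refl _)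
      (fun x => leafIso (Hom.ofTrans ρ) (Hom.id 𝒴) x) (fun x => rfl)
        (fun f => ?_) (fun g => ?_)
        (fun x => ?_) fun x => ?_) |>.symm
  · refine (Category.comp_id _).trans (Eq.trans ?_ (Category.id_comp _).symm)
    exact f.comm.symm
  · exact pullFunctor_map_leaf (Hom.ofTrans ρ) (Hom.id 𝒴) g
  · refine (congrArg (_ ≫ ·) ((Hom.comp_θ_app (collapse R 𝒴) (split ρ 𝒴) x).trans
      (Category.id_comp _))).trans ?_
    exact (Category.comp_id _).trans (congrArg 𝔹.act.map (Category.comp_id _).symm)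
  · refine (congrArg (_ ≫ ·) ((Hom.comp_τ_app (collapse R 𝒴) (split ρ 𝒴) x).trans
      ((Category.id_comp _).trans (split_τ_app ρ 𝒴 x)))).trans ?_
    refine (tensorHom_comp_tensorHom _ _ _ _).trans (congrArg₂ (· ⊗ₘ ·) ?_ ?_)
    · exact (congrArg (· ≫ _) (R.map_id _)).trans (Category.id_comp _)
    · refine (Category.comp_id _).trans (congrArg (bigTensor C).map ?_)
      exact (Category.comp_id _).symm

end Cell

lemma distrApp_natural {C : Type u} [Category.{v} C] [MonoidalCategory C] [SymmetricCategory C]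
    {x y : Wreath (C × Wreath C)} (f : x ⟶ y) :
    ((bigTensor C).map ((Wreath.map (CategoryTheory.Prod.fst C (Wreath C))).map f) ⊗ₘ
      (bigTensor C).map ((Wreath.mu C).map ((Wreath.map (CategoryTheory.Prod.snd C (Wreath C))).map f))) ≫
        distrApp (fun t => (y.lbl t).1) (fun t => (y.lbl t).2)
    = distrApp (fun t => (x.lbl t).1) (fun t => (x.lbl t).2) ≫
      (bigTensor C).map ((Wreath.map (CategoryTheory.Prod.fst C (Wreath C) ⊗
        (CategoryTheory.Prod.snd C (Wreath C) ⋙ bigTensor C))).map f) :=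
  (distr (CategoryTheory.Prod.fst C (Wreath C)) (CategoryTheory.Prod.snd C (Wreath C))).naturality f

lemma assoc_tensor_square {C : Type u} [Category.{v} C] [MonoidalCategory C]
    {x₁ x₂ x₃ a₁ a₂ a₃ b₁ b₂ b₃ c₂ c₃ : C} {u : x₁ ⟶ x₂} {r : x₂ ⟶ x₃} {r' : x₁ ⟶ x₃}
    {a : a₁ ⟶ a₂} {e : a₂ ⟶ a₃} {a' : a₁ ⟶ a₃} {b : b₁ ⟶ b₂} {f : b₂ ⟶ b₃} {b' : b₁ ⟶ b₃}
    {d : a₂ ⊗ b₂ ⟶ c₂} {d' : a₃ ⊗ b₃ ⟶ c₃} {c : c₂ ⟶ c₃} (hr : u ≫ r = r') (ha : a ≫ e = a')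
    (hb : b ≫ f = b') (h : (e ⊗ₘ f) ≫ d' = d ≫ c) :
    ((u ⊗ₘ a) ⊗ₘ b) ≫ ((α_ x₂ a₂ b₂).hom ≫ x₂ ◁ d) ≫ (r ⊗ₘ c)
      = ((r' ⊗ₘ a') ⊗ₘ b') ≫ (α_ x₃ a₃ b₃).hom ≫ x₃ ◁ d' := by
  subst hr ha hb
  rw [Category.assoc, associator_naturality_assoc, associator_naturality_assoc, ← id_tensorHom,
    ← id_tensorHom, tensorHom_comp_tensorHom, Category.id_comp, ← h, tensorHom_comp_tensorHom,
    tensorHom_comp_tensorHom, Category.comp_id, tensorHom_comp_tensorHom_assoc]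

namespace Cell

variable {C : Type u} [Category.{v} C] {𝔹 : Base}

/-- The functor on trees underlying the associativity of `⊚`. -/
abbrev regroup (𝒳 𝒴 : Cell Base.sigma C) (𝒵 : Cell 𝔹 C) :
    Pull 𝒳.p (Pull 𝒴.p 𝒵.E) ⥤ Pull (Pull.snd 𝒳.p 𝒴.E ⋙ Wreath.map 𝒴.p ⋙ gammaTwo) 𝒵.E where
  obj x := ⟨⟨x.tree, fun t => (x.lbl t).tree⟩, fun s => (x.lbl s.1).lbl s.2⟩
  map f := ⟨⟨f.tree, (Wreath.map (Pull.fst 𝒴.p 𝒵.E)).map f.leaf, f.comm⟩,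
    (Wreath.mu 𝒵.E).map ((Wreath.map (Pull.snd 𝒴.p 𝒵.E)).map f.leaf),
    congrArg (Equiv.sigmaCongr f.leaf.σ) (funext fun t => (f.leaf.φ t).comm)⟩
  map_id x := Pull.Hom.ext (by rfl)
    ((Wreath.map (Pull.snd 𝒴.p 𝒵.E) ⋙ Wreath.mu 𝒵.E).map_id x.wreath)
  map_comp f g := Pull.Hom.ext (by rfl)
    ((Wreath.map (Pull.snd 𝒴.p 𝒵.E) ⋙ Wreath.mu 𝒵.E).map_comp f.leaf g.leaf)

section Leaves

variable {𝒳 𝒳' : Cell Base.sigma C} {𝒴 𝒴' : Cell 𝔹 C}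

lemma leafMap_whisker (h : Hom 𝒳 𝒳') (k : Hom 𝒴 𝒴') {D : Type u₁} [Category.{v₁} D]
    {D' : Type u₂} [Category.{v₂} D'] {Z : 𝒴.E ⥤ D} {Z' : 𝒴'.E ⥤ D} (β : k.q ⋙ Z ⟶ Z')
    (T : D ⥤ D') (x : Pull 𝒳'.p 𝒴'.E) :
    (leafMap (Z := Z ⋙ T) (Z' := Z' ⋙ T) h k (Functor.whiskerRight β T)).app x
      = (Wreath.map T).map ((leafMap h k β).app x) :=
  ((Wreath.map T).map_comp ((Wreath.map Z).map (leafIso h k x).hom)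
    ((Wreath.mapNat β).app x.wreath)).symm

/-- The decorated leaves of pulled back trees, naturally. -/
def leafNatIso (h : Hom 𝒳 𝒳') (k : Hom 𝒴 𝒴') :
    pullFunctor h k ⋙ Pull.snd 𝒳.p 𝒴.E ≅ Pull.snd 𝒳'.p 𝒴'.E ⋙ Wreath.map k.q :=
  NatIso.ofComponents (leafIso h k) fun f => pullFunctor_map_leaf h k f

end Leaves

variable [MonoidalCategory C] [SymmetricCategory C]

/-- The associativity of `⊚`. -/
noncomputable def assocHom (𝒳 𝒴 : Cell Base.sigma C) (𝒵 : Cell 𝔹 C) :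
    Hom (odot (odot 𝒳 𝒴) 𝒵) (odot 𝒳 (odot 𝒴 𝒵)) where
  q := regroup 𝒳 𝒴 𝒵
  θ := Functor.isoWhiskerLeft (Pull.snd 𝒳.p (Pull 𝒴.p 𝒵.E) ⋙
    Wreath.map (Pull.snd 𝒴.p 𝒵.E) ⋙ Wreath.map (Wreath.map 𝒵.p)) 𝔹.assocIso
  τ := ((α_ (Pull.fst 𝒳.p (Pull 𝒴.p 𝒵.E) ⋙ 𝒳.Y)
      (Pull.snd 𝒳.p (Pull 𝒴.p 𝒵.E) ⋙ Wreath.map (Pull.fst 𝒴.p 𝒵.E ⋙ 𝒴.Y) ⋙ bigTensor C)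
      (Pull.snd 𝒳.p (Pull 𝒴.p 𝒵.E) ⋙ Wreath.map (Pull.snd 𝒴.p 𝒵.E ⋙ Wreath.map 𝒵.Y) ⋙
        Wreath.mu C ⋙ bigTensor C)).hom ≫
    ((Pull.fst 𝒳.p (Pull 𝒴.p 𝒵.E) ⋙ 𝒳.Y) ◁ Functor.whiskerLeft (Pull.snd 𝒳.p (Pull 𝒴.p 𝒵.E))
      (distr (Pull.fst 𝒴.p 𝒵.E ⋙ 𝒴.Y) (Pull.snd 𝒴.p 𝒵.E ⋙ Wreath.map 𝒵.Y))) :)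

section Naturality

variable {𝒳 𝒳' 𝒴 𝒴' : Cell Base.sigma C} {𝒵 𝒵' : Cell 𝔹 C} (h : Hom 𝒳 𝒳') (k : Hom 𝒴 𝒴')
  (l : Hom 𝒵 𝒵')

/-- The comparison of the two ways of pulling back a twofold decorated tree, on inner trees. -/
noncomputable def innerIso (x : Pull 𝒳'.p (Pull 𝒴'.p 𝒵'.E)) :
    (pullObj h (k.odot l) x).wreath ≅ (Wreath.map (pullFunctor k l)).obj x.wreath :=
  leafIso h (k.odot l) x

/-- The leaves of the inner trees. -/
noncomputable def outerIso (x : Pull 𝒳'.p (Pull 𝒴'.p 𝒵'.E)) :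
    (Wreath.mu 𝒵.E).obj ((Wreath.map (Pull.snd 𝒴.p 𝒵.E)).obj (pullObj h (k.odot l) x).wreath) ≅
      (Wreath.map l.q).obj ((Wreath.mu 𝒵'.E).obj ((Wreath.map (Pull.snd 𝒴'.p 𝒵'.E)).obj x.wreath)) :=
  (Wreath.mu 𝒵.E).mapIso ((Wreath.map (Pull.snd 𝒴.p 𝒵.E)).mapIso (innerIso h k l x) ≪≫
    (Wreath.mapNatIso (leafNatIso k l)).app x.wreath)

/-- The roots of the inner trees. -/
noncomputable def rootIso (x : Pull 𝒳'.p (Pull 𝒴'.p 𝒵'.E)) :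
    (Wreath.map (Pull.fst 𝒴.p 𝒵.E)).obj (pullObj h (k.odot l) x).wreath ≅
      (Wreath.map k.q).obj ((Wreath.map (Pull.fst 𝒴'.p 𝒵'.E)).obj x.wreath) :=
  (Wreath.map (Pull.fst 𝒴.p 𝒵.E)).mapIso (innerIso h k l x)

lemma map_fst_gammaTwo {x y : Wreath (Pull 𝒴.p 𝒵.E)} (f : x ⟶ y) :
    (Wreath.map 𝒴.p ⋙ gammaTwo).map ((Wreath.map (Pull.fst 𝒴.p 𝒵.E)).map f)
      = (Wreath.mu 𝒵.E ⋙ Wreath.forget 𝒵.E).map ((Wreath.map (Pull.snd 𝒴.p 𝒵.E)).map f) :=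
  congrArg (Equiv.sigmaCongr f.σ) (funext fun t => (f.φ t).comm.symm)

lemma rootIso_comp (x : Pull 𝒳'.p (Pull 𝒴'.p 𝒵'.E)) :
    (Wreath.map 𝒴.p ⋙ gammaTwo).map (rootIso h k l x).hom ≫ gammaTwo.map
      ((Wreath.mapNat k.θ.hom).app ((Wreath.map (Pull.fst 𝒴'.p 𝒵'.E)).obj x.wreath))
    = (Wreath.forget 𝒵.E).map (outerIso h k l x).hom := by
  refine (congrArg (· ≫ _) (map_fst_gammaTwo (innerIso h k l x).hom)).trans ?_
  exact ((Wreath.mu 𝒵.E ⋙ Wreath.forget 𝒵.E).map_comp _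
    ((Wreath.mapNat (leafNatIso k l).hom).app x.wreath)).symm

/-- The comparison of the two ways of pulling back a twofold decorated tree, on trees. -/
noncomputable def treeCompare (x : Pull 𝒳'.p (Pull 𝒴'.p 𝒵'.E)) :
    (pullObj (h.odot k) l ((regroup 𝒳' 𝒴' 𝒵').obj x)).tree ≅
      ((regroup 𝒳 𝒴 𝒵).obj (pullObj h (k.odot l) x)).tree :=
  pullIso (Iso.refl _)
    (leafIso h k ((regroup 𝒳' 𝒴' 𝒵').obj x).tree ≪≫ (rootIso h k l x).symm)
    (Wreath.σ_comp_inv (leafIso h k ((regroup 𝒳' 𝒴' 𝒵').obj x).tree).hom (rootIso h k l x)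
      (𝒳.p.map (𝟙 _)) ((Category.id_comp _).symm.trans
        (congrArg (· ≫ _) (𝒳.p.map_id _).symm)))

/-- The comparison of the two ways of pulling back a twofold decorated tree, on leaves. -/
noncomputable def wreathCompare (x : Pull 𝒳'.p (Pull 𝒴'.p 𝒵'.E)) :
    (pullObj (h.odot k) l ((regroup 𝒳' 𝒴' 𝒵').obj x)).wreath ≅
      ((regroup 𝒳 𝒴 𝒵).obj (pullObj h (k.odot l) x)).wreath :=
  leafIso (h.odot k) l ((regroup 𝒳' 𝒴' 𝒵').obj x) ≪≫ (outerIso h k l x).symm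

lemma wreathCompare_comp (x : Pull 𝒳'.p (Pull 𝒴'.p 𝒵'.E)) {D : Type u₁} [Category.{v₁} D]
    {Z : 𝒵.E ⥤ D} {Z' : 𝒵'.E ⥤ D} (β : l.q ⋙ Z ⟶ Z') :
    (Wreath.map Z).map (wreathCompare h k l x).hom ≫
      (Wreath.mu D).map ((leafMap h (k.odot l) (leafMap k l β)).app x)
    = (leafMap (h.odot k) l β).app ((regroup 𝒳' 𝒴' 𝒵').obj x) := by
  have e : (Wreath.mu D).map ((leafMap h (k.odot l) (leafMap k l β)).app x)
      = (Wreath.map Z).map (outerIso h k l x).hom ≫ (Wreath.mapNat β).app ((Wreath.mu 𝒵'.E).obj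
        ((Wreath.map (Pull.snd 𝒴'.p 𝒵'.E)).obj x.wreath)) := by
    refine Wreath.Hom.ext' (fun _ => rfl) fun s => (Category.comp_id _).trans ?_
    refine Eq.trans ?_ (congrArg (· ≫ _) (Z.map_comp _ _).symm)
    exact (Category.assoc _ _ _).symm
  rw [e]
  exact map_comp_inv_comp (Wreath.map Z) (leafIso (h.odot k) l ((regroup 𝒳' 𝒴' 𝒵').obj x)).hom
    (outerIso h k l x) ((Wreath.mapNat β).app ((Wreath.mu 𝒵'.E).obj
      ((Wreath.map (Pull.snd 𝒴'.p 𝒵'.E)).obj x.wreath)))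

lemma treeCompare_leaf (x : Pull 𝒳'.p (Pull 𝒴'.p 𝒵'.E)) :
    (treeCompare h k l x).hom.leaf
      = (leafIso h k ((regroup 𝒳' 𝒴' 𝒵').obj x).tree).hom ≫ (rootIso h k l x).inv := rfl

lemma treeCompare_comp (x : Pull 𝒳'.p (Pull 𝒴'.p 𝒵'.E)) {D : Type u₁} [Category.{v₁} D]
    {Z : 𝒴.E ⥤ D} {Z' : 𝒴'.E ⥤ D} (β : k.q ⋙ Z ⟶ Z') :
    (Wreath.map Z).map (treeCompare h k l x).hom.leaf ≫
      (Wreath.map Z).map (rootIso h k l x).hom ≫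
        (Wreath.mapNat β).app ((Wreath.map (Pull.fst 𝒴'.p 𝒵'.E)).obj x.wreath)
    = (leafMap h k β).app ((regroup 𝒳' 𝒴' 𝒵').obj x).tree := by
  rw [treeCompare_leaf]
  exact map_comp_inv_comp (Wreath.map Z) (leafIso h k ((regroup 𝒳' 𝒴' 𝒵').obj x).tree).hom
    (rootIso h k l x)
    ((Wreath.mapNat β).app ((Wreath.map (Pull.fst 𝒴'.p 𝒵'.E)).obj x.wreath))

lemma Hom.assoc_natural_rel : (((h.odot k).odot l).comp (assocHom 𝒳' 𝒴' 𝒵')).Rel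
    ((assocHom 𝒳 𝒴 𝒵).comp (h.odot (k.odot l))) := by
  refine Hom.Rel.of_odot (treeCompare h k l) (wreathCompare h k l) (fun x => ?_) (fun {x y} f => ?_)
    (fun {x y} f => ?_) (fun x => ?_) (fun x => ?_)
  · refine Wreath.σ_comp_inv (leafIso (h.odot k) l ((regroup 𝒳' 𝒴' 𝒵').obj x)).hom
      (outerIso h k l x) (((Cell.odot 𝒳 𝒴).p).map (treeCompare h k l x).hom) ?_
    refine Eq.trans ?_ (congrArg (_ ≫ ·) (rootIso_comp h k l x))
    exact (congrArg gammaTwo.map (treeCompare_comp h k l x k.θ.hom)).symm.trans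
      ((gammaTwo.map_comp _ _).trans (congrArg (_ ≫ ·) (gammaTwo.map_comp _ _)))
  · refine Pull.Hom.ext ((Category.comp_id _).trans (Category.id_comp _).symm) ?_
    refine natural_of_isos
      (j := (Wreath.map k.q).map ((Wreath.map (Pull.fst 𝒴'.p 𝒵'.E)).map f.leaf))
      (pullFunctor_map_leaf h k ((regroup 𝒳' 𝒴' 𝒵').map f).tree) ?_
    refine ((Wreath.map (Pull.fst 𝒴.p 𝒵.E)).map_comp _ _).symm.trans ?_
    refine (congrArg (Wreath.map (Pull.fst 𝒴.p 𝒵.E)).map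
      (pullFunctor_map_leaf h (k.odot l) f)).trans ?_
    exact (Wreath.map (Pull.fst 𝒴.p 𝒵.E)).map_comp _ _
  · refine natural_of_isos
      (j := (Wreath.map l.q).map ((regroup 𝒳' 𝒴' 𝒵').map f).leaf)
      (pullFunctor_map_leaf (h.odot k) l ((regroup 𝒳' 𝒴' 𝒵').map f)) ?_
    refine ((Wreath.mu 𝒵.E).map_comp _ _).symm.trans (Eq.trans (congrArg (Wreath.mu 𝒵.E).map
      (map_square_comp (Wreath.map (Pull.snd 𝒴.p 𝒵.E)) (pullFunctor_map_leaf h (k.odot l) f)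
        ((Wreath.mapNat (leafNatIso k l).hom).naturality f.leaf))) ?_)
    exact (Wreath.mu 𝒵.E).map_comp _ _
  · refine (congrArg (_ ≫ ·) (Hom.comp_θ_app (assocHom 𝒳 𝒴 𝒵) (h.odot (k.odot l)) x)).trans
      (Eq.trans ?_ (Hom.comp_θ_app ((h.odot k).odot l) (assocHom 𝒳' 𝒴' 𝒵') x).symm)
    have n : 𝔹.assocIso.hom.app _ ≫ (h.odot (k.odot l)).θ.hom.app x
      = 𝔹.act.map ((Wreath.mu 𝔹.B).map ((leafMap h (k.odot l) (leafMap k l l.θ.hom)).app x)) ≫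
        𝔹.assocIso.hom.app _ := by
      refine Eq.trans ?_ (𝔹.assocIso.hom.naturality _).symm
      refine congrArg (_ ≫ ·) (congrArg 𝔹.act.map ?_)
      exact leafMap_whisker h (k.odot l) (leafMap k l l.θ.hom) 𝔹.act x
    refine (congrArg (_ ≫ ·) n).trans ((Category.assoc _ _ _).symm.trans (congrArg (· ≫ _) ?_))
    refine (𝔹.act.map_comp _ _).symm.trans (congrArg 𝔹.act.map ?_)
    exact wreathCompare_comp h k l x l.θ.hom
  · refine (congrArg (_ ≫ ·) (Hom.comp_τ_app (assocHom 𝒳 𝒴 𝒵) (h.odot (k.odot l)) x)).trans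
      (Eq.trans ?_ (Hom.comp_τ_app ((h.odot k).odot l) (assocHom 𝒳' 𝒴' 𝒵') x).symm)
    let J : Pull 𝒴.p 𝒵.E ⥤ C × Wreath C :=
      (Pull.fst 𝒴.p 𝒵.E ⋙ 𝒴.Y).prod' (Pull.snd 𝒴.p 𝒵.E ⋙ Wreath.map 𝒵.Y)
    let J' : Pull 𝒴'.p 𝒵'.E ⥤ C × Wreath C :=
      (Pull.fst 𝒴'.p 𝒵'.E ⋙ 𝒴'.Y).prod' (Pull.snd 𝒴'.p 𝒵'.E ⋙ Wreath.map 𝒵'.Y)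
    let β : pullFunctor k l ⋙ J ⟶ J' :=
      { app := fun x => (k.τ.app x.tree, (leafMap k l l.τ).app x)
        naturality := fun _ _ f => Prod.ext (k.τ.naturality f.tree)
          ((leafMap k l l.τ).naturality f) }
    have ha : (bigTensor C).map ((Wreath.map 𝒴.Y).map (treeCompare h k l x).hom.leaf) ≫
        (bigTensor C).map ((Wreath.map (CategoryTheory.Prod.fst C (Wreath C))).map
          ((leafMap h (k.odot l) β).app x))
        = (bigTensor C).map ((leafMap h k k.τ).app ((regroup 𝒳' 𝒴' 𝒵').obj x).tree) :=
      ((bigTensor C).map_comp _ _).symm.trans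
        (congrArg (bigTensor C).map (treeCompare_comp h k l x k.τ))
    have hb : (bigTensor C).map ((Wreath.map 𝒵.Y).map (wreathCompare h k l x).hom) ≫
        (bigTensor C).map ((Wreath.mu C).map
          ((Wreath.map (CategoryTheory.Prod.snd C (Wreath C))).map
            ((leafMap h (k.odot l) β).app x)))
        = (bigTensor C).map ((leafMap (h.odot k) l l.τ).app ((regroup 𝒳' 𝒴' 𝒵').obj x)) :=
      ((bigTensor C).map_comp _ _).symm.trans
        (congrArg (bigTensor C).map (wreathCompare_comp h k l x l.τ))
    have hd := distrApp_natural ((leafMap h (k.odot l) β).app x)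
    exact assoc_tensor_square ((congrArg (· ≫ _) (𝒳.Y.map_id _)).trans (Category.id_comp _))
      ha hb (hd.trans (congrArg (fun f => distrApp _ _ ≫ (bigTensor C).map f)
        (leafMap_whisker h (k.odot l) β (CategoryTheory.Prod.fst C (Wreath C) ⊗
          (CategoryTheory.Prod.snd C (Wreath C) ⋙ bigTensor C)) x).symm))

end Naturality

/-- The associativity of `⊚`. -/
noncomputable def assocMap (𝒳 𝒴 : Cell Base.sigma C) (𝒵 : Cell 𝔹 C) :
    odot (odot 𝒳 𝒴) 𝒵 ⟶ odot 𝒳 (odot 𝒴 𝒵) := (assocHom 𝒳 𝒴 𝒵).cls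

lemma assocMap_natural {𝒳 𝒳' 𝒴 𝒴' : Cell Base.sigma C} {𝒵 𝒵' : Cell 𝔹 C} (f : 𝒳 ⟶ 𝒳')
    (g : 𝒴 ⟶ 𝒴') (h : 𝒵 ⟶ 𝒵') :
    odotMap (odotMap f g) h ≫ assocMap 𝒳' 𝒴' 𝒵' = assocMap 𝒳 𝒴 𝒵 ≫ odotMap f (odotMap g h) := by
  obtain ⟨f, rfl⟩ := cls_surjective f
  obtain ⟨g, rfl⟩ := cls_surjective g
  obtain ⟨h, rfl⟩ := cls_surjective h
  exact (Hom.assoc_natural_rel f g h).cls_eq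

lemma odotMap_collapse_comp_assoc (A : FinBij ⥤ C) (𝒴 : Cell Base.sigma C) (𝒵 : Cell 𝔹 C) :
    odotMap (collapseIso A 𝒴).hom (𝟙 𝒵) ≫ (assoc A 𝒴 𝒵).cls
      = assocMap (base (𝔹 := Base.sigma) A) 𝒴 𝒵 ≫ (collapseIso A (odot 𝒴 𝒵)).hom := by
  refine Hom.Rel.cls_eq (h := ((collapse A 𝒴).odot (Hom.id 𝒵)).comp (assoc A 𝒴 𝒵))
    (k := (assocHom (base (𝔹 := Base.sigma) A) 𝒴 𝒵).comp (collapse A (odot 𝒴 𝒵)))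
    (Hom.Rel.of_odot (fun x => Iso.refl _)
      (fun x => leafIso (collapse A 𝒴) (Hom.id 𝒵) ((assoc A 𝒴 𝒵).q.obj x)) (fun x => ?_)
        (fun f => ?_) (fun g => ?_)
        (fun x => ?_) fun x => ?_)
  · exact ((odot (base (𝔹 := Base.sigma) A) 𝒴).p.map_id _).symm
  · exact (Category.comp_id _).trans (Category.id_comp _).symm
  · exact pullFunctor_map_leaf (collapse A 𝒴) (Hom.id 𝒵) ((assoc A 𝒴 𝒵).q.map g)
  · refine (congrArg (_ ≫ ·) ((Hom.comp_θ_app (assocHom (base (𝔹 := Base.sigma) A) 𝒴 𝒵)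
      (collapse A (odot 𝒴 𝒵)) x).trans (Category.comp_id _))).trans (Eq.trans ?_
      (Hom.comp_θ_app ((collapse A 𝒴).odot (Hom.id 𝒵)) (assoc A 𝒴 𝒵) x).symm)
    exact congrArg (· ≫ _) (congrArg 𝔹.act.map (Category.comp_id _).symm)
  · refine (congrArg (_ ≫ ·) ((Hom.comp_τ_app (assocHom (base (𝔹 := Base.sigma) A) 𝒴 𝒵)
      (collapse A (odot 𝒴 𝒵)) x).trans (Category.comp_id _))).trans (Eq.trans ?_
      (Hom.comp_τ_app ((collapse A 𝒴).odot (Hom.id 𝒵)) (assoc A 𝒴 𝒵) x).symm)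
    refine congrArg (· ≫ _) (congrArg₂ (· ⊗ₘ ·)
      ((odot (base (𝔹 := Base.sigma) A) 𝒴).Y.map_id _) ?_)
    exact congrArg (bigTensor C).map (Category.comp_id _).symm

end Cell

open Cell

variable {C : Type u} [Category.{v} C] [MonoidalCategory C] [SymmetricCategory C]

section Coassociativity

/-- A transformation `M γ² ⟶ A ⊚ N`, as a morphism of cells. -/
noncomputable def cocompMap {𝔹 : Base} {A : FinBij ⥤ C} {M N : 𝔹.B ⥤ C}
    (Δ : (circ A (base N)).p ⋙ M ⟶ (circ A (base N)).Y) :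
    base M ⟶ odot (base (𝔹 := Base.sigma) A) (base N) :=
  transMap Δ ≫ (collapseIso A (base N)).inv

lemma cocompMap_comp_collapse {𝔹 : Base} {A : FinBij ⥤ C} {M N : 𝔹.B ⥤ C}
    (Δ : (circ A (base N)).p ⋙ M ⟶ (circ A (base N)).Y) :
    cocompMap Δ ≫ (collapseIso A (base N)).hom = transMap Δ := by
  simp [cocompMap]

lemma collapse_comp_circ {A : FinBij ⥤ C} {𝔹 : Base} {𝒴 𝒴' : Cell 𝔹 C} (h : Hom 𝒴 𝒴') :
    (collapseIso A 𝒴).hom ≫ (Hom.circ (𝟙 A) h).cls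
      = odotMap (𝟙 (base (𝔹 := Base.sigma) A)) h.cls ≫ (collapseIso A 𝒴').hom := by
  rw [← odotMap_comp_collapse, baseMap_id]

lemma collapse_comp_assoc (A : FinBij ⥤ C) (𝒴 : Cell Base.sigma C) {𝔹 : Base} (𝒵 : Cell 𝔹 C)
    {𝒳 : Cell Base.sigma C} (f : 𝒳 ⟶ circ A 𝒴) :
    odotMap f (𝟙 𝒵) ≫ (assoc A 𝒴 𝒵).cls = odotMap (f ≫ (collapseIso A 𝒴).inv) (𝟙 𝒵) ≫
      assocMap (base (𝔹 := Base.sigma) A) 𝒴 𝒵 ≫ (collapseIso A (odot 𝒴 𝒵)).hom := by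
  rw [← odotMap_collapse_comp_assoc, ← Category.assoc, ← odotMap_comp]
  simp

lemma collapse_comp_coface {A : FinBij ⥤ C}
    (Δ : (circ A (base (𝔹 := Base.sigma) A)).p ⋙ A ⟶ (circ A (base (𝔹 := Base.sigma) A)).Y)
    {𝔹 : Base} (𝒴 : Cell 𝔹 C) :
    (collapseIso A 𝒴).hom ≫ (coface Δ 𝒴).cls = odotMap (cocompMap Δ) (𝟙 𝒴) ≫
      assocMap (base (𝔹 := Base.sigma) A) (base (𝔹 := Base.sigma) A) 𝒴 ≫
      odotMap (𝟙 (base (𝔹 := Base.sigma) A)) (collapseIso A 𝒴).hom ≫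
      (collapseIso A (circ A 𝒴)).hom := by
  have e : (coface Δ 𝒴).cls = (split (𝒳 := circ A (base (𝔹 := Base.sigma) A)) Δ 𝒴).cls ≫
      (assoc A (base (𝔹 := Base.sigma) A) 𝒴).cls ≫ (Hom.circ (𝟙 A) (collapse A 𝒴)).cls :=
    Category.assoc (split (𝒳 := circ A (base (𝔹 := Base.sigma) A)) Δ 𝒴).cls
      (assoc A (base (𝔹 := Base.sigma) A) 𝒴).cls (Hom.circ (𝟙 A) (collapse A 𝒴)).cls
  have e' := collapse_comp_circ (A := A) (collapse A 𝒴)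
  have e'' := collapse_comp_split (𝒳 := circ A (base (𝔹 := Base.sigma) A)) Δ 𝒴
  have e₃ := collapse_comp_assoc A (base (𝔹 := Base.sigma) A) 𝒴
    (transMap (𝒳 := circ A (base (𝔹 := Base.sigma) A)) Δ)
  rw [e, reassoc_of% e'', reassoc_of% e₃, e']
  rfl

lemma diag_comp_assoc {𝒜 ℰ 𝒱 : Cell Base.sigma C} {𝔹 : Base} {𝒩 𝒲 ℛ : Cell 𝔹 C}
    {d : 𝒩 ⟶ odot 𝒜 𝒩} {δ : 𝒜 ⟶ odot 𝒜 𝒜}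
    (hd : d ≫ odotMap δ (𝟙 𝒩) ≫ assocMap 𝒜 𝒜 𝒩 = d ≫ odotMap (𝟙 𝒜) d)
    (e : 𝒜 ⟶ ℰ) (v : 𝒜 ⟶ 𝒱) (w : 𝒩 ⟶ 𝒲) (R : odot 𝒱 𝒲 ⟶ ℛ) :
    d ≫ odotMap (δ ≫ odotMap e v) w ≫ assocMap ℰ 𝒱 𝒲 ≫ odotMap (𝟙 ℰ) R
      = d ≫ odotMap e (d ≫ odotMap v w ≫ R) := by
  have e₁ := odotMap_comp δ (odotMap e v) (𝟙 𝒩) w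
  have e₂ := assocMap_natural e v w
  have e₃ := odotMap_comp e (𝟙 ℰ) (odotMap v w) R
  have e₄ := odotMap_comp (𝟙 𝒜) e d (odotMap v w ≫ R)
  rw [Category.id_comp] at e₁ e₄
  rw [Category.comp_id] at e₃
  rw [e₁, Category.assoc, reassoc_of% e₂, reassoc_of% hd, ← e₃, e₄]

lemma assoc_comp_circ (A : FinBij ⥤ C) {𝒴 ℰ 𝒱 : Cell Base.sigma C} {𝔹 : Base}
    {𝒵 𝒮 𝒲 ℛ : Cell 𝔹 C} (F : Hom (odot 𝒴 𝒵) 𝒮) (e : base (𝔹 := Base.sigma) A ⟶ ℰ)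
    (v : 𝒴 ⟶ 𝒱) (w : 𝒵 ⟶ 𝒲) (R : odot 𝒱 𝒲 ⟶ ℛ) (s : 𝒮 ⟶ ℛ)
    (h : F.cls ≫ s = odotMap v w ≫ R) :
    ((assoc A 𝒴 𝒵).cls ≫ (Hom.circ (𝟙 A) F).cls) ≫ (collapseIso A 𝒮).inv ≫ odotMap e s
      = odotMap ((collapseIso A 𝒴).inv ≫ odotMap e v) w ≫ assocMap ℰ 𝒱 𝒲 ≫
        odotMap (𝟙 ℰ) R := by
  have e₀ := collapse_comp_assoc A 𝒴 𝒵 (𝟙 _)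
  rw [odotMap_id, Category.id_comp, Category.id_comp] at e₀
  have e₁ := collapse_comp_circ (A := A) F
  have e₂ := odotMap_comp (𝟙 _) e F.cls s
  have e₃ := odotMap_comp e (𝟙 ℰ) (odotMap v w) R
  have e₄ := odotMap_comp (collapseIso A 𝒴).inv (odotMap e v) (𝟙 _) w
  have e₅ := assocMap_natural e v w
  rw [Category.id_comp, h] at e₂
  rw [Category.comp_id] at e₃
  rw [Category.id_comp] at e₄
  rw [e₀, e₄]
  simp only [Category.assoc]
  rw [reassoc_of% e₁, Iso.hom_inv_id_assoc, ← e₂, e₃, reassoc_of% e₅]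

end Coassociativity

variable [HasLimitsOfSize.{0, 0} C]

/-- The cocomposition of a comodule. -/
noncomputable def Comodule.coact {O : Cooperad C} {𝔹 : Base} (X : Comodule O 𝔹) :
    base X.M ⟶ odot (base (𝔹 := Base.sigma) O.A) (base X.M) := cocompMap X.Δ

lemma Comodule.coact_coassoc {O : Cooperad C} {𝔹 : Base} (X : Comodule O 𝔹) :
    X.coact ≫ odotMap O.self.coact (𝟙 (base X.M)) ≫
      assocMap (base (𝔹 := Base.sigma) O.A) (base (𝔹 := Base.sigma) O.A) (base X.M)
    = X.coact ≫ odotMap (𝟙 (base (𝔹 := Base.sigma) O.A)) X.coact := by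
  have h := congrArg transMap X.coassoc
  have e : transMap X.Δ = X.coact ≫ (collapseIso O.A (base X.M)).hom :=
    (cocompMap_comp_collapse X.Δ).symm
  have e₁ := collapse_comp_coface O.Δ (base X.M)
  have e₂ := collapse_comp_circ (A := O.A) (Hom.ofTrans X.Δ)
  have e₃ : (Hom.ofTrans X.Δ).cls = transMap X.Δ := rfl
  have e₄ := odotMap_comp (𝟙 (base (𝔹 := Base.sigma) O.A)) (𝟙 (base (𝔹 := Base.sigma) O.A))
    X.coact (collapseIso O.A (base X.M)).hom
  rw [Category.id_comp] at e₄
  rw [← transMap_comp_cls, ← transMap_comp_cls, e, Category.assoc, Category.assoc, e₁, e₂, e₃, e,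
    e₄] at h
  have e₅ := odotMap_comp (𝟙 (base (𝔹 := Base.sigma) O.A)) (𝟙 (base (𝔹 := Base.sigma) O.A))
    (collapseIso O.A (base X.M)).hom (collapseIso O.A (base X.M)).inv
  rw [Category.id_comp, Iso.hom_inv_id, odotMap_id] at e₅
  have h' := congrArg (· ≫ (collapseIso O.A (circ O.A (base X.M))).inv ≫
    odotMap (𝟙 (base (𝔹 := Base.sigma) O.A)) (collapseIso O.A (base X.M)).inv) h
  simp only [Category.assoc, Iso.hom_inv_id_assoc, ← e₅, Category.comp_id] at h'
  exact h'

mutual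

/-- The product of cells obtained from an expression by forgetting all Kan extensions. -/
noncomputable def Expr.tree (A : FinBij ⥤ C) : Expr → ∀ {𝔹 : Base}, (𝔹.B ⥤ C) → Cell 𝔹 C
  | .atom, _, M => base M
  | .node e w, _, M => odot (e.tree A (𝔹 := Base.sigma) A) (w.tree A M)

/-- The product of cells obtained from a sequence of factors by forgetting all Kan extensions. -/
noncomputable def Word.tree (A : FinBij ⥤ C) : Word → ∀ {𝔹 : Base}, (𝔹.B ⥤ C) → Cell 𝔹 C
  | .single e, _, M => e.tree A M
  | .cons e w, _, M => odot (e.tree A (𝔹 := Base.sigma) A) (w.tree A M)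

end

mutual

/-- The removal of all parentheses of an expression. -/
noncomputable def Expr.out (A : FinBij ⥤ C) : (e : Expr) → ∀ {𝔹 : Base} (M : 𝔹.B ⥤ C),
    base (e.eval A M) ⟶ e.tree A M
  | .atom, _, M => 𝟙 (base M)
  | .node e w, _, M =>
    transMap (circ (e.eval A (𝔹 := Base.sigma) A) (w.cell A M)).ι ≫
      (collapseIso (e.eval A (𝔹 := Base.sigma) A) (w.cell A M)).inv ≫
        odotMap (e.out A (𝔹 := Base.sigma) A) (w.out A M)

/-- The removal of all parentheses of a sequence of factors. -/
noncomputable def Word.out (A : FinBij ⥤ C) : (w : Word) → ∀ {𝔹 : Base} (M : 𝔹.B ⥤ C),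
    w.cell A M ⟶ w.tree A M
  | .single e, _, M => e.out A M
  | .cons e w, _, M => (collapseIso (e.eval A (𝔹 := Base.sigma) A) (w.cell A M)).inv ≫
        odotMap (e.out A (𝔹 := Base.sigma) A) (w.out A M)

end

mutual

/-- The iterated cocomposition, with the bracketing given by an expression. -/
noncomputable def Expr.diag {O : Cooperad C} : (e : Expr) → ∀ {𝔹 : Base} (X : Comodule O 𝔹),
    base X.M ⟶ e.tree O.A X.M
  | .atom, _, X => 𝟙 (base X.M)
  | .node e w, _, X => X.coact ≫ odotMap (e.diag O.self) (w.diag X)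

/-- The iterated cocomposition, with the bracketing given by a sequence of factors. -/
noncomputable def Word.diag {O : Cooperad C} : (w : Word) → ∀ {𝔹 : Base} (X : Comodule O 𝔹),
    base X.M ⟶ w.tree O.A X.M
  | .single e, _, X => e.diag X
  | .cons e w, _, X => X.coact ≫ odotMap (e.diag O.self) (w.diag X)

end

/-- The reassociation belonging to a concatenation of sequences of factors. -/
noncomputable def Word.reassoc (A : FinBij ⥤ C) {𝔹 : Base} (M : 𝔹.B ⥤ C) : (w' w : Word) →
    (odot (w'.tree A (𝔹 := Base.sigma) A) (w.tree A M) ⟶ (w'.append w).tree A M)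
  | .single _, _ => 𝟙 _
  | .cons e v, w => assocMap (e.tree A (𝔹 := Base.sigma) A) (v.tree A (𝔹 := Base.sigma) A)
      (w.tree A M) ≫ odotMap (𝟙 _) (v.reassoc A M w)

lemma reassoc_diag {O : Cooperad C} {𝔹 : Base} (X : Comodule O 𝔹) : ∀ w' w : Word,
    X.coact ≫ odotMap (w'.diag O.self) (w.diag X) ≫ w'.reassoc O.A X.M w
      = (w'.append w).diag X
  | .single e, w => congrArg (X.coact ≫ ·) (Category.comp_id _)
  | .cons e v, w =>
    (diag_comp_assoc X.coact_coassoc (e.diag O.self) (v.diag O.self) (w.diag X)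
      (v.reassoc O.A X.M w)).trans
        (congrArg (fun t => X.coact ≫ odotMap (e.diag O.self) t) (reassoc_diag X v w))

lemma flatten_out (A : FinBij ⥤ C) {𝔹 : Base} (M : 𝔹.B ⥤ C) : ∀ w' w : Word,
    (flatten A M w' w).cls ≫ (w'.append w).out A M
      = odotMap (w'.out A (𝔹 := Base.sigma) A) (w.out A M) ≫ w'.reassoc A M w
  | .single e, w => by
    refine Eq.trans ?_ (Category.comp_id _).symm
    exact Iso.hom_inv_id_assoc (collapseIso _ _) _
  | .cons e v, w => assoc_comp_circ (e.eval A (𝔹 := Base.sigma) A) (flatten A M v w)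
      (e.out A (𝔹 := Base.sigma) A) (v.out A (𝔹 := Base.sigma) A) (w.out A M)
      (v.reassoc A M w) ((v.append w).out A M) (flatten_out A M v w)

section Factorization

variable {𝔹 : Base}

lemma comp_eq_of_factors {𝒟 : Type*} [Category 𝒟] {X X' X'' Y Y' Y'' : 𝒟} {a : X ⟶ X'}
    {b : X' ⟶ X''} {o : X ⟶ Y} {o' : X' ⟶ Y'} {o'' : X'' ⟶ Y''} {k : Y ⟶ Y'} {l : Y' ⟶ Y''}
    (h : a ≫ o' = o ≫ k) (h' : b ≫ o'' = o' ≫ l) : (a ≫ b) ≫ o'' = o ≫ k ≫ l := by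
  rw [Category.assoc, h', reassoc_of% h]

lemma odotMap_comp_of_factors {𝒳 𝒳' : Cell Base.sigma C} {𝒴 𝒴' 𝒲 : Cell 𝔹 C}
    {𝒵 : Cell Base.sigma C} {d : 𝒲 ⟶ odot 𝒵 𝒲} {a : 𝒵 ⟶ 𝒳} {b : 𝒲 ⟶ 𝒴} {a' : 𝒵 ⟶ 𝒳'}
    {b' : 𝒲 ⟶ 𝒴'} {k : 𝒳 ⟶ 𝒳'} {l : 𝒴 ⟶ 𝒴'} (h : a ≫ k = a') (h' : b ≫ l = b') :
    (d ≫ odotMap a b) ≫ odotMap k l = d ≫ odotMap a' b' := by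
  rw [Category.assoc, ← odotMap_comp, h, h']

lemma circ_comp_of_factors {A A' : FinBij ⥤ C} {𝒳 𝒳' : Cell Base.sigma C}
    {𝒴 𝒴' 𝒲 𝒲' : Cell 𝔹 C} {f : A ⟶ A'} {h : Hom 𝒴 𝒴'} {a : base (𝔹 := Base.sigma) A ⟶ 𝒳}
    {a' : base (𝔹 := Base.sigma) A' ⟶ 𝒳'} {b : 𝒴 ⟶ 𝒲} {b' : 𝒴' ⟶ 𝒲'} {k : 𝒳 ⟶ 𝒳'}
    {l : 𝒲 ⟶ 𝒲'} (hf : baseMap f ≫ a' = a ≫ k) (hh : h.cls ≫ b' = b ≫ l) :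
    (Hom.circ f h).cls ≫ (collapseIso A' 𝒴').inv ≫ odotMap a' b'
      = ((collapseIso A 𝒴).inv ≫ odotMap a b) ≫ odotMap k l := by
  have e := odotMap_comp_collapse f h
  rw [← Iso.inv_comp_eq, ← Category.assoc, ← Iso.eq_comp_inv] at e
  rw [← Category.assoc, ← e, Category.assoc, Category.assoc, ← odotMap_comp, ← odotMap_comp, hf,
    hh]

lemma split_comp_of_factors {R : FinBij ⥤ C} {𝒳 𝒲 : Cell Base.sigma C} (ρ : 𝒳.p ⋙ R ⟶ 𝒳.Y)
    {𝒴 𝒮 𝒵 𝒵' : Cell 𝔹 C} {F : Hom (odot 𝒳 𝒴) 𝒮} {s : 𝒮 ⟶ 𝒵'} {a : 𝒳 ⟶ 𝒲} {b : 𝒴 ⟶ 𝒵}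
    {k : odot 𝒲 𝒵 ⟶ 𝒵'} (h : F.cls ≫ s = odotMap a b ≫ k) :
    ((split ρ 𝒴).cls ≫ F.cls) ≫ s
      = ((collapseIso R 𝒴).inv ≫ odotMap (transMap ρ ≫ a) b) ≫ k := by
  have e := collapse_comp_split ρ 𝒴
  rw [← Iso.eq_inv_comp] at e
  have e' := odotMap_comp (transMap ρ) a (𝟙 𝒴) b
  rw [Category.id_comp] at e'
  rw [e, e', Category.assoc, Category.assoc, h]
  simp

lemma coface_comp_out {A : FinBij ⥤ C}
    (Δ : (circ A (base (𝔹 := Base.sigma) A)).p ⋙ A ⟶ (circ A (base (𝔹 := Base.sigma) A)).Y)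
    {𝒴 𝒵 : Cell 𝔹 C} (s : 𝒴 ⟶ 𝒵) :
    (coface Δ 𝒴).cls ≫ (collapseIso A (circ A 𝒴)).inv ≫
        odotMap (𝟙 _) ((collapseIso A 𝒴).inv ≫ odotMap (𝟙 _) s)
      = ((collapseIso A 𝒴).inv ≫ odotMap (𝟙 _) s) ≫ odotMap (cocompMap Δ) (𝟙 𝒵) ≫
        assocMap (base (𝔹 := Base.sigma) A) (base (𝔹 := Base.sigma) A) 𝒵 := by
  have e := collapse_comp_coface Δ 𝒴
  rw [← Iso.eq_inv_comp] at e
  have e₁ := odotMap_comp (𝟙 (base (𝔹 := Base.sigma) A)) (𝟙 _) (collapseIso A 𝒴).hom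
    ((collapseIso A 𝒴).inv ≫ odotMap (𝟙 _) s)
  have e₂ := assocMap_natural (𝟙 (base (𝔹 := Base.sigma) A)) (𝟙 (base (𝔹 := Base.sigma) A)) s
  have e₃ := odotMap_comp (𝟙 (base (𝔹 := Base.sigma) A)) (cocompMap Δ) s (𝟙 _)
  have e₄ := odotMap_comp (cocompMap Δ) (𝟙 _) (𝟙 _) s
  rw [Category.id_comp, Iso.hom_inv_id_assoc] at e₁
  rw [odotMap_id] at e₂
  rw [Category.id_comp, Category.comp_id] at e₃ e₄
  rw [e]
  simp only [Category.assoc, Iso.hom_inv_id_assoc]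
  rw [← e₁, ← e₂, ← reassoc_of% e₃, e₄, Category.assoc]

lemma diag_comp_coface {𝒜 : Cell Base.sigma C} {𝒩 𝒲 : Cell 𝔹 C}
    {d : 𝒩 ⟶ odot 𝒜 𝒩} {δ : 𝒜 ⟶ odot 𝒜 𝒜}
    (hd : d ≫ odotMap δ (𝟙 𝒩) ≫ assocMap 𝒜 𝒜 𝒩 = d ≫ odotMap (𝟙 𝒜) d) (w : 𝒩 ⟶ 𝒲) :
    (d ≫ odotMap (𝟙 𝒜) w) ≫ odotMap δ (𝟙 𝒲) ≫ assocMap 𝒜 𝒜 𝒲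
      = d ≫ odotMap (𝟙 𝒜) (d ≫ odotMap (𝟙 𝒜) w) := by
  have e := diag_comp_assoc hd (𝟙 𝒜) (𝟙 𝒜) w (𝟙 _)
  have e' := odotMap_comp (𝟙 𝒜) δ w (𝟙 𝒲)
  simp only [odotMap_id, Category.comp_id, Category.id_comp] at e e'
  rw [← e, e']
  simp

lemma comp_odotMap_id_id {𝒳 : Cell 𝔹 C} {𝒜 : Cell Base.sigma C} {ℬ : Cell 𝔹 C}
    (f : 𝒳 ⟶ odot 𝒜 ℬ) : f ≫ odotMap (𝟙 𝒜) (𝟙 ℬ) = 𝟙 𝒳 ≫ f := by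
  rw [odotMap_id, Category.comp_id, Category.id_comp]

end Factorization

lemma lift_comp_out {𝔹 : Base} {M : 𝔹.B ⥤ C} {𝒳 : Cell 𝔹 C} (α : 𝒳.p ⋙ M ⟶ 𝒳.Y)
    {𝒴 𝒵 : Cell 𝔹 C} (i : 𝒳 ⟶ 𝒴) (j : 𝒴 ⟶ 𝒵) :
    baseMap (𝒳.lift α) ≫ transMap 𝒳.ι ≫ i ≫ j = (transMap α ≫ i) ≫ j := by
  rw [← Category.assoc, baseMap_lift_comp_ι, Category.assoc]

lemma baseMap_injective {𝔹 : Base} {M N : 𝔹.B ⥤ C} {f g : M ⟶ N} (h : baseMap f = baseMap g) :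
    f = g := by
  have e := (baseMap_comp_transMap f (𝒳 := base N) (𝟙 N)).symm.trans
    ((congrArg (· ≫ transMap (𝒳 := base N) (𝟙 N)) h).trans
      (baseMap_comp_transMap g (𝒳 := base N) (𝟙 N)))
  ext x
  have e' := congrArg (fun t : M ⟶ N => t.app x) (transMap_injective e)
  exact (Category.comp_id _).symm.trans (e'.trans (Category.comp_id _))

lemma lift_hom_ext_of_retraction {𝔹 : Base} {G : 𝔹.B ⥤ C} {𝒳 𝒴 : Cell 𝔹 C} {f g : G ⟶ 𝒳.hat}
    {s : 𝒳 ⟶ 𝒴} {J : 𝒴 ⟶ 𝒳} (hJ : s ≫ J = 𝟙 𝒳) {K L : base G ⟶ 𝒴}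
    (hf : baseMap f ≫ transMap 𝒳.ι ≫ s = 𝟙 _ ≫ K) (hg : baseMap g ≫ transMap 𝒳.ι ≫ s = 𝟙 _ ≫ L)
    (h : 𝟙 _ ≫ K = 𝟙 _ ≫ L) : f = g := by
  refine hat_hom_ext ?_
  have e := congrArg (· ≫ J) (hf.trans (h.trans hg.symm))
  simpa only [Category.assoc, hJ, Category.comp_id] using e

lemma retraction_collapse {A : FinBij ⥤ C} {𝔹 : Base} {𝒴 𝒵 : Cell 𝔹 C} {s : 𝒴 ⟶ 𝒵} {J : 𝒵 ⟶ 𝒴}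
    (hJ : s ≫ J = 𝟙 𝒴) :
    ((collapseIso A 𝒴).inv ≫ odotMap (𝟙 _) s) ≫ odotMap (𝟙 _) J ≫ (collapseIso A 𝒴).hom
      = 𝟙 _ := by
  have e := odotMap_comp (𝟙 (base (𝔹 := Base.sigma) A)) (𝟙 _) s J
  rw [Category.id_comp, hJ, odotMap_id] at e
  rw [Category.assoc, ← reassoc_of% e, Iso.inv_hom_id]

lemma hat_comp_of_factors {𝔹 : Base} {𝒳 𝒳' 𝒴 𝒴' : Cell 𝔹 C} {h : Hom 𝒳 𝒳'} {a : 𝒳 ⟶ 𝒴}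
    {a' : 𝒳' ⟶ 𝒴'} {k : 𝒴 ⟶ 𝒴'} (e : h.cls ≫ a' = a ≫ k) :
    baseMap h.hat ≫ transMap 𝒳'.ι ≫ a' = (transMap 𝒳.ι ≫ a) ≫ k := by
  rw [← Category.assoc, baseMap_hat_comp_ι, Category.assoc, Category.assoc, e]

mutual

theorem EMap.exists_tree {O : Cooperad C} {𝔹 : Base} {X : Comodule O 𝔹} {e e' : Expr}
    {f : e.eval O.A X.M ⟶ e'.eval O.A X.M} : EMap X e e' f →
    ∃ K : e.tree O.A X.M ⟶ e'.tree O.A X.M,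
      baseMap f ≫ e'.out O.A X.M = e.out O.A X.M ≫ K ∧ e.diag X ≫ K = e'.diag X
  | .id _ _ => ⟨𝟙 _, by rw [baseMap_id, Category.id_comp, Category.comp_id], Category.comp_id _⟩
  | .comp _ h h' => by
    obtain ⟨K, hK, hd⟩ := h.exists_tree
    obtain ⟨L, hL, hd'⟩ := h'.exists_tree
    refine ⟨K ≫ L, ?_, ?_⟩
    · rw [baseMap_comp]
      exact comp_eq_of_factors hK hL
    · rw [← Category.assoc, hd, hd']
  | .cocomp X =>
    ⟨X.coact, (lift_comp_out X.Δ _ _).trans (comp_odotMap_id_id X.coact),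
      (comp_odotMap_id_id X.coact).symm⟩
  | .kan _ h => by
    obtain ⟨K, hK, hd⟩ := h.exists_tree
    exact ⟨K, hat_comp_of_factors hK, hd⟩

theorem WMap.exists_tree {O : Cooperad C} {𝔹 : Base} {X : Comodule O 𝔹} {w w' : Word}
    {h : Hom (w.cell O.A X.M) (w'.cell O.A X.M)} : WMap X w w' h →
    ∃ K : w.tree O.A X.M ⟶ w'.tree O.A X.M,
      h.cls ≫ w'.out O.A X.M = w.out O.A X.M ≫ K ∧ w.diag X ≫ K = w'.diag X
  | .id _ _ => ⟨𝟙 _, by rw [cls_id, Category.id_comp, Category.comp_id], Category.comp_id _⟩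
  | .single _ h => h.exists_tree
  | .cons _ h h' => by
    obtain ⟨K, hK, hd⟩ := h.exists_tree
    obtain ⟨L, hL, hd'⟩ := h'.exists_tree
    exact ⟨odotMap K L, circ_comp_of_factors hK hL, odotMap_comp_of_factors hd hd'⟩
  | .paren X e w' w =>
    ⟨(Word.cons e w').reassoc O.A X.M w,
      split_comp_of_factors _ (flatten_out O.A X.M (.cons e w') w),
      (Category.assoc _ _ _).trans (reassoc_diag X (.cons e w') w)⟩
  | .parenLast _ _ _ => ⟨𝟙 _, (Category.comp_id _).symm, Category.comp_id _⟩
  | .coface X w =>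
    ⟨odotMap O.self.coact (𝟙 _) ≫ assocMap _ _ _, coface_comp_out O.Δ (w.out O.A X.M),
      diag_comp_coface X.coact_coassoc (w.diag X)⟩
  | .cofaceLast X =>
    ⟨X.coact, (Category.assoc _ _ _).symm.trans (comp_odotMap_id_id X.coact),
      (comp_odotMap_id_id X.coact).symm⟩

end

lemma Word.exists_retraction_out_flat (A : FinBij ⥤ C) {𝔹 : Base} (M : 𝔹.B ⥤ C) : ∀ k : ℕ,
    ∃ J : (Word.flat k).tree A M ⟶ (Word.flat k).cell A M, (Word.flat k).out A M ≫ J = 𝟙 _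
  | 0 => ⟨𝟙 (base M), Category.comp_id _⟩
  | k + 1 => by
    obtain ⟨J, hJ⟩ := Word.exists_retraction_out_flat A M k
    exact ⟨odotMap (𝟙 _) J ≫ (collapseIso A ((Word.flat k).cell A M)).hom,
      retraction_collapse hJ⟩

lemma EMap.flat_unique {O : Cooperad C} {𝔹 : Base} {X : Comodule O 𝔹} (k : ℕ)
    {f g : X.M ⟶ (Expr.flat k).eval O.A X.M} (hf : EMap X .atom (.flat k) f)
    (hg : EMap X .atom (.flat k) g) : f = g := by
  obtain ⟨K, hK, hd⟩ := hf.exists_tree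
  obtain ⟨L, hL, hd'⟩ := hg.exists_tree
  cases k with
  | zero =>
    exact baseMap_injective ((Category.comp_id _).symm.trans ((hK.trans (hd.trans hd'.symm)).trans
      (hL.symm.trans (Category.comp_id _))))
  | succ k =>
    obtain ⟨J, hJ⟩ := Word.exists_retraction_out_flat O.A X.M (k + 1)
    exact lift_hom_ext_of_retraction hJ hK hL (hd.trans hd'.symm)

lemma WMap.exists_flat_succ {O : Cooperad C} {𝔹 : Base} (X : Comodule O 𝔹) : ∀ k : ℕ,
    ∃ h, WMap X (.flat k) (.flat (k + 1)) h
  | 0 => ⟨_, .cofaceLast X⟩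
  | k + 1 => by
    obtain ⟨h, hh⟩ := WMap.exists_flat_succ X k
    exact ⟨_, .cons X (.id O.self .atom) hh⟩

lemma EMap.exists_flat {O : Cooperad C} {𝔹 : Base} (X : Comodule O 𝔹) : ∀ k : ℕ,
    ∃ f, EMap X .atom (.flat k) f
  | 0 => ⟨_, .id X .atom⟩
  | 1 => ⟨_, .cocomp X⟩
  | k + 2 => by
    obtain ⟨f, hf⟩ := EMap.exists_flat X (k + 1)
    obtain ⟨h, hh⟩ := WMap.exists_flat_succ X (k + 1)
    exact ⟨_, .comp X hf (.kan X hh)⟩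

end TreeSeq

theorem corollaryC {C : Type u} [Category.{v} C] [MonoidalCategory C] [SymmetricCategory C]
    [HasLimitsOfSize.{0, 0} C] (O : TreeSeq.Cooperad C) :
    (∀ (M : TreeSeq.Comodule O TreeSeq.Base.sigma) (k : ℕ),
      ∃! f : M.M ⟶ (TreeSeq.Expr.flat k).eval O.A M.M,
        TreeSeq.EMap M .atom (.flat k) f) ∧
    (∀ (c : TreeSeq.Coalgebra O) (k : ℕ),
      ∃! f : c.c ⟶ c.target k,
        ∃ F : c.toComodule.M ⟶ (TreeSeq.Expr.flat k).eval O.A c.toComodule.M,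
          TreeSeq.EMap c.toComodule .atom (.flat k) F ∧ F.app TreeSeq.emptySet = f) := by
  refine ⟨fun M k => ?_, fun c k => ?_⟩
  · obtain ⟨f, hf⟩ := TreeSeq.EMap.exists_flat M k
    exact ⟨f, hf, fun g hg => hg.flat_unique k hf⟩
  · obtain ⟨F, hF⟩ := TreeSeq.EMap.exists_flat c.toComodule k
    refine ⟨F.app TreeSeq.emptySet, ⟨F, hF, rfl⟩, ?_⟩
    rintro _ ⟨G, hG, rfl⟩
    rw [hG.flat_unique k hF]
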